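/- Let $d\ge 1$, let $\mathcal P$ be a homogeneous Poisson process of intensity $1$ on $\mathbb R^d$, and let $\mu$ be a probability measure on the strictly positive integers. Write $[\Lambda]=\{x:\Lambda(\{x\})>0\}$ for the point set of a point measure $\Lambda$. Let $\xi$ be a random integer-valued measure on $\mathbb R^d$ with $[\xi]=[\mathcal P]$ a.s. which, conditionally on $\mathcal P$, assigns i.i.d. values with law $\mu$ to the points of $[\mathcal P]$; put $D_x=\xi(\{x\})$, the number of stubs at $x\in[\mathcal P]$. Distances are Euclidean. A matching scheme for $(\mathcal P,\xi)$ is a point process $\mathcal M$ on $(\mathbb R^d)^2$ such that a.s. $[\mathcal M]$ is the edge set of a simple undirected graph (no loops, no multiple edges; an edge $\{x,y\}$ is represented by unit masses at both $(x,y)$ and $(y,x)$) with vertex set $[\mathcal P]$ in which each $x\in[\mathcal P]$ has degree $D_x$, and such that the law of $\mathcal M$ is invariant under all translations of $\mathbb R^d$. It is a stable multi-matching if, moreover, a.s. for any two distinct $x,y\in[\mathcal P]$, either $x$ and $y$ are linked by an edge or at least one of $x$ and $y$ has no incident edge longer than $|x-y|$. Consider the following procedure. Start with $D_x$ stubs at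 each $x\in[\mathcal P]$ and no edges. At each step $n=1,2,\dots$, let $A$ be the set of points of $[\mathcal P]$ that still have at least one stub; call two distinct points of $A$ compatible if no edge has been created between them in an earlier step. Simultaneously create an edge between each pair $x,y$ of compatible points of $A$ such that $y$ is the (strictly) closest point to $x$ among the points of $A$ compatible with $x$, and vice versa; remove one stub from each endpoint of each new edge. The limiting graph consists of all edges created in any step. Proposition. Almost surely every stub is used up after finitely many steps, and the limiting graph is a stable multi-matching of $(\mathcal P,\xi)$. It is the only one: every stable multi-matching $\mathcal M$ of $(\mathcal P,\xi)$ almost surely coincides with the limiting graph. Moreover, almost surely the limiting graph is the only graph with vertex set $[\mathcal P]$ and degrees $(D_x)$ such that for any two distinct $x,y\in[\mathcal P]$, either $x$ and $y$ are linked or one of them has no incident edge longer than $|x-y|$. -/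

import Mathlib

open MeasureTheory ProbabilityTheory
open scoped ENNReal

noncomputable section

namespace MultiMatching

/-! ### Point measures and point processes -/

/-- The set of points `[φ] = {x | φ {x} > 0}` of a measure. -/
def pointSet {S : Type*} [MeasurableSpace S] (φ : Measure S) : Set S :=
  {x | 0 < φ {x}}

/-- A point measure: an integer-valued measure that is finite on bounded sets. -/
def IsPointMeasure {S : Type*} [PseudoMetricSpace S] [MeasurableSpace S] (φ : Measure S) : Prop :=
  ∀ B : Set S, MeasurableSet B → Bornology.IsBounded B → ∃ n : ℕ, φ B = n

/-- A point process: a random element of the space of point measures.  (`Measure S` carries the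
σ-algebra generated by the evaluations at measurable sets.) -/
structure IsPointProcess {S Ω : Type*} [PseudoMetricSpace S] [MeasurableSpace S]
    [MeasurableSpace Ω] (N : Ω → Measure S) : Prop where
  measurable : Measurable N
  isPointMeasure : ∀ ω, IsPointMeasure (N ω)

/-- The homogeneous Poisson process of intensity `1`: the number of points in a measurable set of
finite volume is Poisson distributed with the volume as parameter, and the numbers of points
in disjoint measurable sets are independent. -/
structure IsPoissonProcess {d : ℕ} {Ω : Type*} [MeasurableSpace Ω] (Pr : Measure Ω)
    (P : Ω → Measure (EuclideanSpace ℝ (Fin d))) : Prop where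
  isPointProcess : IsPointProcess P
  count_law : ∀ B : Set (EuclideanSpace ℝ (Fin d)), MeasurableSet B → volume B ≠ ∞ →
    Pr.map (fun ω => P ω B) =
      (poissonMeasure (volume B).toNNReal).map (fun n : ℕ => (n : ℝ≥0∞))
  count_indep : ∀ (n : ℕ) (B : Fin n → Set (EuclideanSpace ℝ (Fin d))),
    (∀ i, MeasurableSet (B i)) → Pairwise (fun i j => Disjoint (B i) (B j)) →
      iIndepFun (fun i ω => P ω (B i)) Pr

/-! ### Marks -/

/-- The measure on `E` with mass `k x` at each `x ∈ A`, and no other mass. -/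
def markedMeasure {E : Type*} [MeasurableSpace E] (A : Set E) (k : A → ℕ) : Measure E :=
  Measure.sum fun x : A => (k x : ℝ≥0∞) • Measure.dirac (x : E)

/-- The law of the random measure that puts independent masses with law `μ` on the points
of the (countable) set `A`. -/
def iidMarkLaw {E : Type*} [MeasurableSpace E] (μ : Measure ℕ) [IsProbabilityMeasure μ]
    (A : Set E) : Measure (Measure E) :=
  (Measure.infinitePi fun _ : A => μ).map (markedMeasure A)

/-- `ξ` is a random integer-valued measure with the same points as `P` which, conditionally on
`P`, assigns i.i.d. values with law `μ` to the points of `P`: the measures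
`iidMarkLaw μ [P ω]` are a conditional distribution of `ξ` given `P`. -/
structure IsIIDMarking {E Ω : Type*} [PseudoMetricSpace E] [MeasurableSpace E]
    [MeasurableSpace Ω] (Pr : Measure Ω) (μ : Measure ℕ) [IsProbabilityMeasure μ]
    (P ξ : Ω → Measure E) : Prop where
  isPointProcess : IsPointProcess ξ
  pointSet_eq : ∀ᵐ ω ∂Pr, pointSet (ξ ω) = pointSet (P ω)
  cond_law : ∀ A : Set (Measure E × Measure E), MeasurableSet A →
    Pr {ω | (P ω, ξ ω) ∈ A} =
      ∫⁻ ω, iidMarkLaw μ (pointSet (P ω)) {m | (P ω, m) ∈ A} ∂Pr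

/-- The number of stubs `D_x = ξ {x}`, as a natural number. -/
def stubCount {E : Type*} [MeasurableSpace E] (m : Measure E) (x : E) : ℕ :=
  ⌊(m {x}).toReal⌋₊

/-! ### Matching schemes and stability -/

/-- The simple graph on the points of `E` whose edges are the pairs of distinct points in `[m]`. -/
def edgeGraph {E : Type*} [MeasurableSpace E] (m : Measure (E × E)) : SimpleGraph E :=
  SimpleGraph.fromRel fun x y => (x, y) ∈ pointSet m

/-- The counting measure of the edges of a graph; an undirected edge `{x, y}` is represented by
both ordered pairs `(x, y)` and `(y, x)`. -/
def edgeMeasure {E : Type*} [MeasurableSpace E] (G : SimpleGraph E) : Measure (E × E) :=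
  Measure.sum fun e : {p : E × E // G.Adj p.1 p.2} => Measure.dirac (e : E × E)

/-- The edges of `G` join points of `S`, and each `x ∈ S` has degree `D x`. -/
structure IsMatchingOn {E : Type*} (S : Set E) (D : E → ℕ) (G : SimpleGraph E) : Prop where
  mem_of_adj : ∀ x y, G.Adj x y → x ∈ S ∧ y ∈ S
  degree_eq : ∀ x ∈ S, (G.neighborSet x).encard = (D x : ℕ∞)

/-- Any two distinct points of `S` are linked, or one of them has no incident edge that
is longer than their distance. -/
def IsStableOn {E : Type*} [PseudoMetricSpace E] (S : Set E) (G : SimpleGraph E) : Prop :=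
  ∀ x ∈ S, ∀ y ∈ S, x ≠ y →
    G.Adj x y ∨ (∀ z, G.Adj x z → dist x z ≤ dist x y) ∨ (∀ z, G.Adj y z → dist y z ≤ dist x y)

/-- A simple translation-invariant matching scheme for the marked process `(P, ξ)`. -/
structure IsMatchingScheme {d : ℕ} {Ω : Type*} [MeasurableSpace Ω] (Pr : Measure Ω)
    (P ξ : Ω → Measure (EuclideanSpace ℝ (Fin d)))
    (M : Ω → Measure (EuclideanSpace ℝ (Fin d) × EuclideanSpace ℝ (Fin d))) : Prop where
  isPointProcess : IsPointProcess M
  /-- Edges are undirected. -/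
  symm : ∀ᵐ ω ∂Pr, ∀ x y, M ω {(x, y)} = M ω {(y, x)}
  /-- There are no self-loops. -/
  no_loops : ∀ᵐ ω ∂Pr, ∀ x, M ω {(x, x)} = 0
  /-- There are no multiple edges. -/
  no_multiple : ∀ᵐ ω ∂Pr, ∀ x y, M ω {(x, y)} ≤ 1
  /-- Edges join points of `P`, and each point `x` of `P` has degree `D_x`. -/
  isMatchingOn : ∀ᵐ ω ∂Pr, IsMatchingOn (pointSet (P ω)) (stubCount (ξ ω)) (edgeGraph (M ω))
  /-- The law of `M` is invariant under all translations. -/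
  translation_invariant : ∀ v : EuclideanSpace ℝ (Fin d),
    Pr.map (fun ω => (M ω).map fun p => (p.1 + v, p.2 + v)) = Pr.map M

/-- A stable multi-matching of the marked process `(P, ξ)`. -/
structure IsStableMultiMatching {d : ℕ} {Ω : Type*} [MeasurableSpace Ω] (Pr : Measure Ω)
    (P ξ : Ω → Measure (EuclideanSpace ℝ (Fin d)))
    (M : Ω → Measure (EuclideanSpace ℝ (Fin d) × EuclideanSpace ℝ (Fin d))) : Prop
    extends IsMatchingScheme Pr P ξ M where
  stable : ∀ᵐ ω ∂Pr, IsStableOn (pointSet (P ω)) (edgeGraph (M ω))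

/-! ### The iterative procedure -/

section Procedure

/-- `y` is the closest point to `x` among the points of `A` that are compatible with `x`, that is,
differ from `x` and are not linked to `x` by an edge of `G`. -/
def IsClosestCompatible {E : Type*} [PseudoMetricSpace E] (G : SimpleGraph E) (A : Set E)
    (x y : E) : Prop :=
  y ∈ A ∧ y ≠ x ∧ ¬ G.Adj x y ∧
    ∀ z ∈ A, z ≠ x → z ≠ y → ¬ G.Adj x z → dist x y < dist x z

/-- The graph of all compatible mutually closest pairs in `A`. -/
def mutuallyClosest {E : Type*} [PseudoMetricSpace E] (G : SimpleGraph E) (A : Set E) :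
    SimpleGraph E where
  Adj x y := IsClosestCompatible G A x y ∧ IsClosestCompatible G A y x
  symm := ⟨fun _ _ h => ⟨h.2, h.1⟩⟩
  loopless := ⟨fun _ h => h.1.2.1 rfl⟩

/-- A stage of the procedure: the edges created so far, and the numbers of remaining stubs. -/
structure Stage (E : Type*) where
  graph : SimpleGraph E
  stubs : E → ℕ

/-- The points of `S` that still have at least one stub. -/
def Stage.active {E : Type*} (S : Set E) (s : Stage E) : Set E :=
  {x ∈ S | 1 ≤ s.stubs x}

open Classical in
/-- One step: an edge is created between each compatible mutually closest pair in the set of points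
with a remaining stub, and one stub is removed from each of the two points. -/
def Stage.step {E : Type*} [PseudoMetricSpace E] (S : Set E) (s : Stage E) : Stage E where
  graph := s.graph ⊔ mutuallyClosest s.graph (s.active S)
  stubs x :=
    if ∃ y, (mutuallyClosest s.graph (s.active S)).Adj x y then s.stubs x - 1 else s.stubs x

/-- The stage after `n` steps, started from the point set `S` with `D x` stubs at `x` and without
edges. -/
def stageAfter {E : Type*} [PseudoMetricSpace E] (S : Set E) (D : E → ℕ) (n : ℕ) : Stage E :=
  (Stage.step S)^[n] ⟨⊥, D⟩

/-- The limiting graph, consisting of the edges created in any step. -/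
def limitGraph {E : Type*} [PseudoMetricSpace E] (S : Set E) (D : E → ℕ) : SimpleGraph E :=
  ⨆ n, (stageAfter S D n).graph

/-- Every stub is used up after finitely many steps. -/
def ExhaustsStubs {E : Type*} [PseudoMetricSpace E] (S : Set E) (D : E → ℕ) : Prop :=
  ∀ x ∈ S, ∃ n, (stageAfter S D n).stubs x = 0

end Procedure

/-- The point process of edges of the limiting graph of the procedure on `(P, ξ)`. -/
def limitScheme {E Ω : Type*} [PseudoMetricSpace E] [MeasurableSpace E]
    (P ξ : Ω → Measure E) (ω : Ω) : Measure (E × E) :=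
  edgeMeasure (limitGraph (pointSet (P ω)) (stubCount (ξ ω)))

end MultiMatching

end

/-!
The argument separates what holds for every configuration from what needs the Poisson process.

*For every configuration.* A step creates at most one edge at each point, so created edges and
remaining stubs at `x` always add up to `D x`. If all stubs are used up, the limiting graph is a
matching with the right degrees, and it is stable: two points that are never linked stay
compatible while both are active, so the first of them to run out of stubs has only edges that are
at most as long as their distance (`ExhaustsStubs.isStableOn`). Conversely, by induction on the
steps, every stable matching contains all edges that the procedure creates
(`IsMatchingOn.limitGraph_le`), and comparison of degrees gives equality
(`ExhaustsStubs.eq_limitGraph`). Hence both uniqueness claims follow once it is known that almost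
surely all stubs are used up.

*Exhaustion.* In a locally finite set without ties and without descending chains, only finitely
many points keep stubs forever (`finite_unexhausted`): from a point with a compatible partner
among them, moving repeatedly to the closest such partner gives a descending chain. A
translation-invariant random set cannot be finite and nonempty with positive probability
(`ae_not_nonempty_finite_unexhaustedPoints`).

*Ties and chains.* Both are excluded by one estimate, `IsPoissonProcess.measure_exists_path_le`:
the probability of a path of `n` steps through distinct points of the process, started in a given
ball and with step lengths in `[a, b)`, is at most the volume of a ball times the `n`-th power of
the volume of a shell. It comes from a union bound over paths of small disjoint cells. A tie is a
path of two steps in a common thin shell, and the step lengths of a descending chain eventually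
lie in a common shell of small volume.

*Invariance.* The law of a Poisson process is determined by its counts
(`IsPoissonProcess.map_eq`), so it is invariant under translations, and so is the law of the
process with its marks (`IsIIDMarking.map_translatePair_eq`). The limiting graph is an equivariant
measurable function of the marked process. Measurability rests on a measurable enumeration of the
points of a point measure (`exists_isEnumeration`), which makes all quantifiers over points
countable.
-/

namespace MultiMatching

/-! ### The procedure on a fixed marked point set -/

section Procedure

variable {E : Type*}

theorem IsClosestCompatible.unique [PseudoMetricSpace E] {G : SimpleGraph E} {A : Set E}
    {x y z : E} (hy : IsClosestCompatible G A x y) (hz : IsClosestCompatible G A x z) : y = z := by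
  by_contra hne
  exact lt_asymm (hy.2.2.2 z hz.1 hz.2.1 (Ne.symm hne) hz.2.2.1)
    (hz.2.2.2 y hy.1 hy.2.1 hne hy.2.2.1)

variable [PseudoMetricSpace E] {S : Set E} {D : E → ℕ}

theorem stageAfter_succ (S : Set E) (D : E → ℕ) (n : ℕ) :
    stageAfter S D (n + 1) = (stageAfter S D n).step S :=
  Function.iterate_succ_apply' _ _ _

theorem stageAfter_succ_adj {n : ℕ} {x y : E} :
    (stageAfter S D (n + 1)).graph.Adj x y ↔ (stageAfter S D n).graph.Adj x y ∨
      (mutuallyClosest (stageAfter S D n).graph ((stageAfter S D n).active S)).Adj x y := by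
  rw [stageAfter_succ]; rfl

theorem stageAfter_adj_mono {m n : ℕ} (hmn : m ≤ n) {x y : E}
    (h : (stageAfter S D m).graph.Adj x y) : (stageAfter S D n).graph.Adj x y :=
  monotone_nat_of_le_succ (f := fun n => (stageAfter S D n).graph)
    (fun _ _ _ h => stageAfter_succ_adj.2 (Or.inl h)) hmn h

theorem stageAfter_stubs_anti (x : E) : Antitone fun n => (stageAfter S D n).stubs x := by
  refine antitone_nat_of_succ_le fun n => ?_
  rw [stageAfter_succ]
  simp only [Stage.step]
  split_ifs <;> omega

theorem limitGraph_adj {x y : E} :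
    (limitGraph S D).Adj x y ↔ ∃ n, (stageAfter S D n).graph.Adj x y := by
  simp [limitGraph, SimpleGraph.iSup_adj]

theorem stageAfter_adj_mem {n : ℕ} {x y : E} (h : (stageAfter S D n).graph.Adj x y) :
    x ∈ S ∧ y ∈ S := by
  induction n with
  | zero => exact absurd h (by simp [stageAfter])
  | succ n ih =>
    rcases stageAfter_succ_adj.1 h with h | h
    · exact ih h
    · exact ⟨h.2.1.1, h.1.1.1⟩

/-- An edge of the limiting graph is created in some step, between two compatible points that are
the closest to one another among the active ones. -/
theorem exists_step_of_limitGraph_adj {x y : E} (h : (limitGraph S D).Adj x y) :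
    ∃ n, (mutuallyClosest (stageAfter S D n).graph ((stageAfter S D n).active S)).Adj x y := by
  obtain ⟨n, hn⟩ := limitGraph_adj.1 h
  induction n with
  | zero => exact absurd hn (by simp [stageAfter])
  | succ n ih => exact (stageAfter_succ_adj.1 hn).elim ih fun h => ⟨n, h⟩

/-- At every stage, the edges created at `x` and the stubs left at `x` add up to `D x`, since a
step creates at most one edge at each point. -/
theorem encard_neighborSet_add_stubs (n : ℕ) (x : E) :
    ((stageAfter S D n).graph.neighborSet x).encard + (stageAfter S D n).stubs x = D x := by
  induction n with
  | zero => simp [stageAfter, SimpleGraph.neighborSet]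
  | succ n ih =>
    by_cases hy : ∃ y, (mutuallyClosest (stageAfter S D n).graph
        ((stageAfter S D n).active S)).Adj x y
    · have hstub : (stageAfter S D (n + 1)).stubs x = (stageAfter S D n).stubs x - 1 := by
        rw [stageAfter_succ]; exact if_pos hy
      obtain ⟨y, hy⟩ := hy
      have hpos : 1 ≤ (stageAfter S D n).stubs x := hy.2.1.2
      have hset : (stageAfter S D (n + 1)).graph.neighborSet x =
          insert y ((stageAfter S D n).graph.neighborSet x) := by
        ext z
        simp only [SimpleGraph.mem_neighborSet, Set.mem_insert_iff, stageAfter_succ_adj]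
        constructor
        · rintro (h | h)
          · exact Or.inr h
          · exact Or.inl (h.1.unique hy.1)
        · rintro (rfl | h)
          · exact Or.inr hy
          · exact Or.inl h
      have hnot : y ∉ (stageAfter S D n).graph.neighborSet x := hy.1.2.2.1
      rw [hset, Set.encard_insert_of_notMem hnot, hstub, ← ih, add_assoc]
      congr 1
      rw [add_comm]
      exact_mod_cast Nat.sub_add_cancel hpos
    · have hstub : (stageAfter S D (n + 1)).stubs x = (stageAfter S D n).stubs x := by
        rw [stageAfter_succ]; exact if_neg hy
      have hset : (stageAfter S D (n + 1)).graph.neighborSet x =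
          (stageAfter S D n).graph.neighborSet x := by
        ext z
        simp only [SimpleGraph.mem_neighborSet, stageAfter_succ_adj]
        exact or_iff_left fun h => hy ⟨z, h⟩
      rw [hset, hstub, ih]

theorem finite_neighborSet_stageAfter (n : ℕ) (x : E) :
    ((stageAfter S D n).graph.neighborSet x).Finite := by
  rw [← Set.encard_ne_top_iff]
  intro h
  have := encard_neighborSet_add_stubs (S := S) (D := D) n x
  rw [h, top_add] at this
  exact (ENat.natCast_ne_top _) this.symm

theorem neighborSet_eq_of_stubs_eq {m n : ℕ} (hmn : m ≤ n) {x : E}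
    (h : (stageAfter S D n).stubs x = (stageAfter S D m).stubs x) :
    (stageAfter S D n).graph.neighborSet x = (stageAfter S D m).graph.neighborSet x := by
  have hm := encard_neighborSet_add_stubs (S := S) (D := D) m x
  rw [← encard_neighborSet_add_stubs (S := S) (D := D) n x, h] at hm
  refine ((finite_neighborSet_stageAfter m x).eq_of_subset_of_encard_le
    (fun y hy => stageAfter_adj_mono hmn hy) ?_).symm
  exact ((ENat.add_left_injective_of_ne_top (ENat.natCast_ne_top _)) hm).ge

/-- The edges at a given point are all created within finitely many steps. -/
theorem exists_stage_neighborSet_eq (S : Set E) (D : E → ℕ) (x : E) :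
    ∃ n, (∀ m, n ≤ m → (stageAfter S D m).stubs x = (stageAfter S D n).stubs x) ∧
      (limitGraph S D).neighborSet x = (stageAfter S D n).graph.neighborSet x := by
  obtain ⟨n, hn⟩ : ∃ n, ∀ m, (stageAfter S D n).stubs x ≤ (stageAfter S D m).stubs x := by
    have hne : (Set.range fun n => (stageAfter S D n).stubs x).Nonempty := ⟨_, 0, rfl⟩
    obtain ⟨n, hn⟩ := Nat.sInf_mem hne
    exact ⟨n, fun m => hn.trans_le (Nat.sInf_le ⟨m, rfl⟩)⟩
  have hst : ∀ m, n ≤ m → (stageAfter S D m).stubs x = (stageAfter S D n).stubs x :=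
    fun m hm => le_antisymm (stageAfter_stubs_anti x hm) (hn m)
  refine ⟨n, hst, Set.Subset.antisymm (fun y hy => ?_)
    fun y hy => limitGraph_adj.2 ⟨n, hy⟩⟩
  obtain ⟨k, hk⟩ := limitGraph_adj.1 hy
  rw [← neighborSet_eq_of_stubs_eq (le_max_left n k) (hst _ (le_max_left n k))]
  exact stageAfter_adj_mono (le_max_right n k) hk

theorem finite_neighborSet_limitGraph (x : E) : ((limitGraph S D).neighborSet x).Finite := by
  obtain ⟨n, -, h⟩ := exists_stage_neighborSet_eq S D x
  exact h ▸ finite_neighborSet_stageAfter n x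

theorem limitGraph_adj_mem {x y : E} (h : (limitGraph S D).Adj x y) : x ∈ S ∧ y ∈ S := by
  obtain ⟨n, hn⟩ := limitGraph_adj.1 h
  exact stageAfter_adj_mem hn

theorem ExhaustsStubs.isMatchingOn (h : ExhaustsStubs S D) : IsMatchingOn S D (limitGraph S D) where
  mem_of_adj _ _ := limitGraph_adj_mem
  degree_eq x hx := by
    obtain ⟨n, hn, hlim⟩ := exists_stage_neighborSet_eq S D x
    obtain ⟨k, hk⟩ := h x hx
    have h0 : (stageAfter S D n).stubs x = 0 := by
      rw [← hn _ (le_max_left n k)]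
      exact Nat.le_zero.1 (hk ▸ stageAfter_stubs_anti x (le_max_right n k))
    rw [hlim, ← encard_neighborSet_add_stubs (S := S) (D := D) n x, h0]
    simp

/-- Two points that are never linked are compatible throughout, so until the first of them runs out
of stubs both are active, and the edges created at either are no longer than their distance. -/
theorem ExhaustsStubs.isStableOn (h : ExhaustsStubs S D) : IsStableOn S (limitGraph S D) := by
  classical
  intro x hx y hy hxy
  by_cases hadj : (limitGraph S D).Adj x y
  · exact Or.inl hadj
  refine Or.inr ?_
  have hex : ∃ n, (stageAfter S D n).stubs x = 0 ∨ (stageAfter S D n).stubs y = 0 :=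
    (h x hx).imp fun n hn => Or.inl hn
  have hmin : ∀ k, k < Nat.find hex →
      (stageAfter S D k).stubs x ≠ 0 ∧ (stageAfter S D k).stubs y ≠ 0 :=
    fun k hk => not_or.1 (Nat.find_min hex hk)
  have key : ∀ u v, u ∈ S → v ∈ S → u ≠ v → ¬ (limitGraph S D).Adj u v →
      (stageAfter S D (Nat.find hex)).stubs u = 0 →
      (∀ k, k < Nat.find hex → (stageAfter S D k).stubs v ≠ 0) →
      ∀ z, (limitGraph S D).Adj u z → dist u z ≤ dist u v := by
    intro u v hu hv huv hnadj h0 hlt z hz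
    obtain ⟨k, hk⟩ := exists_step_of_limitGraph_adj hz
    by_cases hvz : v = z
    · rw [hvz]
    have hklt : k < Nat.find hex := by
      by_contra hle
      have := stageAfter_stubs_anti (S := S) (D := D) u (not_lt.1 hle)
      have hpos : 1 ≤ (stageAfter S D k).stubs u := hk.2.1.2
      simp only [h0] at this
      omega
    exact (hk.1.2.2.2 v ⟨hv, Nat.one_le_iff_ne_zero.2 (hlt k hklt)⟩ huv.symm hvz
      fun h => hnadj (limitGraph_adj.2 ⟨k, h⟩)).le
  rcases Nat.find_spec hex with h0 | h0
  · exact Or.inl (key x y hx hy hxy hadj h0 fun k hk => (hmin k hk).2)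
  · rw [dist_comm x y]
    exact Or.inr (key y x hy hx hxy.symm (fun h => hadj h.symm) h0 fun k hk => (hmin k hk).1)

/-- If a matching `G` contains the edges created so far, and `x` still has a stub, then `G` has an
edge at `x` that has not been created, and its other end still has a stub. -/
theorem IsMatchingOn.exists_active_adj {G : SimpleGraph E} (hG : IsMatchingOn S D G) {n : ℕ}
    (hle : (stageAfter S D n).graph ≤ G) {x : E} (hx : x ∈ (stageAfter S D n).active S) :
    ∃ z ∈ (stageAfter S D n).active S, G.Adj x z ∧ ¬ (stageAfter S D n).graph.Adj x z := by
  have full : ∀ u ∈ S, (stageAfter S D n).stubs u = 0 ↔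
      (stageAfter S D n).graph.neighborSet u = G.neighborSet u := by
    intro u hu
    have hdeg := encard_neighborSet_add_stubs (S := S) (D := D) n u
    have hGu := hG.degree_eq u hu
    constructor
    · intro h0
      rw [h0, Nat.cast_zero, add_zero, ← hGu] at hdeg
      exact (finite_neighborSet_stageAfter n u).eq_of_subset_of_encard_le (fun y hy => hle hy)
        hdeg.ge
    · intro heq
      have hfin := finite_neighborSet_stageAfter (S := S) (D := D) n u
      rw [← hGu, ← heq] at hdeg
      have : ((stageAfter S D n).stubs u : ℕ∞) = 0 := by
        rw [← Set.encard_ne_top_iff] at hfin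
        exact (ENat.add_right_injective_of_ne_top hfin) (by simpa using hdeg)
      exact_mod_cast this
  have hne : ¬ G.neighborSet x ⊆ (stageAfter S D n).graph.neighborSet x := by
    intro hsub
    have := (full x hx.1).2 (Set.Subset.antisymm (fun y hy => hle hy) hsub)
    have h1 := hx.2
    omega
  obtain ⟨z, hz, hnz⟩ := Set.not_subset.1 hne
  have hzS := (hG.mem_of_adj x z hz).2
  refine ⟨z, ⟨hzS, Nat.one_le_iff_ne_zero.2 fun h0 => hnz ?_⟩, hz, hnz⟩
  have hmem : x ∈ G.neighborSet z := SimpleGraph.Adj.symm hz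
  rw [← (full z hzS).1 h0] at hmem
  exact SimpleGraph.Adj.symm hmem

/-- Every stable matching contains the edges that the procedure creates: if a mutually closest
compatible pair `x, y` were not linked in `G`, stability would bound the length of the `G`-edges at
one of them, say `x`, by `dist x y`, while `x` has a `G`-edge to a compatible active point. -/
theorem IsMatchingOn.limitGraph_le {G : SimpleGraph E} (hG : IsMatchingOn S D G)
    (hst : IsStableOn S G) : limitGraph S D ≤ G := by
  refine iSup_le fun n => ?_
  induction n with
  | zero => exact bot_le
  | succ n ih =>
    intro x y h
    rcases stageAfter_succ_adj.1 h with h | h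
    · exact ih h
    by_contra hxy
    have key : ∀ u v, IsClosestCompatible (stageAfter S D n).graph
        ((stageAfter S D n).active S) u v → u ∈ (stageAfter S D n).active S → ¬ G.Adj u v →
        ¬ ∀ z, G.Adj u z → dist u z ≤ dist u v := by
      intro u v huv hu hadj hall
      obtain ⟨z, hz, hGz, hnz⟩ := hG.exists_active_adj ih hu
      exact absurd (hall z hGz) (not_le.2 (huv.2.2.2 z hz hGz.ne'
        (fun h => hadj (h ▸ hGz)) hnz))
    rcases hst x h.2.1.1 y h.1.1.1 h.1.2.1.symm with h' | h' | h'
    · exact hxy h'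
    · exact key x y h.1 h.2.1 hxy h'
    · exact key y x h.2 h.1.1 (fun h => hxy h.symm) (by rwa [dist_comm y x])

theorem ExhaustsStubs.eq_limitGraph (h : ExhaustsStubs S D) {G : SimpleGraph E}
    (hG : IsMatchingOn S D G) (hst : IsStableOn S G) : G = limitGraph S D := by
  refine le_antisymm (fun x y hxy => ?_) (hG.limitGraph_le hst)
  have hx := (hG.mem_of_adj x y hxy).1
  have : (limitGraph S D).neighborSet x = G.neighborSet x := by
    refine (finite_neighborSet_limitGraph x).eq_of_subset_of_encard_le
      (fun z hz => hG.limitGraph_le hst hz) ?_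
    rw [hG.degree_eq x hx, h.isMatchingOn.degree_eq x hx]
  have hmem : y ∈ G.neighborSet x := hxy
  rwa [← this] at hmem

/-- The points of `S` that have stubs left at every stage. -/
def unexhausted (S : Set E) (D : E → ℕ) : Set E :=
  {x ∈ S | ∀ n, (stageAfter S D n).stubs x ≠ 0}

theorem exhaustsStubs_iff : ExhaustsStubs S D ↔ unexhausted S D = ∅ := by
  simp [ExhaustsStubs, unexhausted, Set.eq_empty_iff_forall_notMem]

/-- No point of `S` has two other points of `S` at the same distance. -/
def HasNoTies (S : Set E) : Prop :=
  ∀ x ∈ S, ∀ y ∈ S, ∀ z ∈ S, x ≠ y → x ≠ z → y ≠ z → dist x y ≠ dist x z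

/-- There is no sequence of distinct points of `S` whose successive distances strictly decrease. -/
def HasNoDescendingChain (S : Set E) : Prop :=
  ¬ ∃ c : ℕ → E, c.Injective ∧ (∀ i, c i ∈ S) ∧ StrictAnti fun i => dist (c i) (c (i + 1))

/-- In a locally finite set without ties, the unexhausted point closest to `u` among those never
linked to `u` is the closest compatible point at all late stages: the finitely many other points
that are at most as far away have run out of stubs or been linked to `u` by then. -/
theorem eventually_isClosestCompatible (hfin : ∀ x r, (S ∩ Metric.closedBall x r).Finite)
    (hties : HasNoTies S) {u w : E} (hu : u ∈ unexhausted S D) (hw : w ∈ unexhausted S D)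
    (hwu : w ≠ u) (hadj : ¬ (limitGraph S D).Adj u w)
    (hmin : ∀ z ∈ unexhausted S D, z ≠ u → ¬ (limitGraph S D).Adj u z → dist u w ≤ dist u z) :
    ∀ᶠ n in Filter.atTop, IsClosestCompatible (stageAfter S D n).graph
      ((stageAfter S D n).active S) u w := by
  have hloc : ∀ z ∈ S ∩ Metric.closedBall u (dist u w), ∀ᶠ n in Filter.atTop,
      z ∈ (stageAfter S D n).active S → ¬ (stageAfter S D n).graph.Adj u z →
        z ∈ unexhausted S D ∧ ¬ (limitGraph S D).Adj u z := by
    intro z hz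
    by_cases h1 : z ∈ unexhausted S D
    · by_cases h2 : (limitGraph S D).Adj u z
      · obtain ⟨n, hn⟩ := limitGraph_adj.1 h2
        filter_upwards [Filter.eventually_ge_atTop n] with m hm _ hnot
        exact absurd (stageAfter_adj_mono hm hn) hnot
      · exact Filter.Eventually.of_forall fun n _ _ => ⟨h1, h2⟩
    · have : ∃ n, (stageAfter S D n).stubs z = 0 := by
        by_contra hcon
        exact h1 ⟨hz.1, not_exists.1 hcon⟩
      obtain ⟨n, hn⟩ := this
      filter_upwards [Filter.eventually_ge_atTop n] with m hm hact _
      have := stageAfter_stubs_anti (S := S) (D := D) z hm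
      have h1 := hact.2
      simp only [hn] at this
      omega
  have hall := ((hfin u (dist u w)).eventually_all).2 hloc
  filter_upwards [hall] with n hn
  refine ⟨⟨hw.1, Nat.one_le_iff_ne_zero.2 (hw.2 n)⟩, hwu,
    fun h => hadj (limitGraph_adj.2 ⟨n, h⟩), fun z hz hzu hzw hnz => ?_⟩
  by_contra hlt
  rw [not_lt] at hlt
  obtain ⟨h1, h2⟩ := hn z ⟨hz.1, by rwa [Metric.mem_closedBall, dist_comm]⟩ hz hnz
  exact hties u hu.1 z hz.1 w hw.1 hzu.symm hwu.symm hzw (le_antisymm hlt (hmin z h1 hzu h2))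

/-- Without ties and descending chains only finitely many points keep stubs forever.  From an
unexhausted point with an unexhausted compatible partner, moving repeatedly to the closest such
partner would give a descending chain; hence the unexhausted points form a clique of the limiting
graph, whose degrees are finite. -/
theorem finite_unexhausted (hfin : ∀ x r, (S ∩ Metric.closedBall x r).Finite)
    (hties : HasNoTies S) (hchain : HasNoDescendingChain S) : (unexhausted S D).Finite := by
  set U : Set E := {u ∈ unexhausted S D | ∃ v ∈ unexhausted S D, v ≠ u ∧
    ¬ (limitGraph S D).Adj u v} with hU
  have hclosest : ∀ u : U, ∃ w : U, (w : E) ≠ u ∧ ¬ (limitGraph S D).Adj u w ∧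
      ∀ z ∈ unexhausted S D, z ≠ u → ¬ (limitGraph S D).Adj u z →
        dist (u : E) w ≤ dist (u : E) z := by
    rintro ⟨u, hu, v, hv, hvu, huv⟩
    set T : Set E := {z ∈ unexhausted S D | z ≠ u ∧ ¬ (limitGraph S D).Adj u z} ∩
      Metric.closedBall u (dist u v) with hT
    have hTfin : T.Finite := (hfin u (dist u v)).subset fun z hz => ⟨hz.1.1.1, hz.2⟩
    have hvT : v ∈ T := ⟨⟨hv, hvu, huv⟩, by rw [Metric.mem_closedBall, dist_comm]⟩
    obtain ⟨w, hwT, hw⟩ := hTfin.exists_minimalFor (fun z => dist u z) T ⟨v, hvT⟩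
    have hw' : ∀ z ∈ T, dist u w ≤ dist u z := fun z hz =>
      (le_total (dist u w) (dist u z)).elim id fun h => hw hz h
    refine ⟨⟨w, hwT.1.1, u, hu, hwT.1.2.1.symm, fun h => hwT.1.2.2 h.symm⟩, hwT.1.2.1,
      hwT.1.2.2, fun z hz hzu hnz => ?_⟩
    rcases le_total (dist u z) (dist u v) with h | h
    · exact hw' z ⟨⟨hz, hzu, hnz⟩, by rwa [Metric.mem_closedBall, dist_comm]⟩
    · exact (hw' v hvT).trans h
  choose f hf1 hf2 hf3 using hclosest
  have hdec : ∀ u : U, dist (f u : E) (f (f u)) < dist (u : E) (f u) := by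
    intro u
    -- otherwise `u` and `f u` would be a mutually closest pair at a late stage, hence be linked
    have hne : (f (f u) : E) ≠ u := by
      intro heq
      have h1 := eventually_isClosestCompatible hfin hties u.2.1 (f u).2.1 (hf1 u) (hf2 u) (hf3 u)
      have h2 := eventually_isClosestCompatible hfin hties (f u).2.1 (f (f u)).2.1 (hf1 (f u))
        (hf2 (f u)) (hf3 (f u))
      rw [heq] at h2
      obtain ⟨n, h1, h2⟩ := (h1.and h2).exists
      exact hf2 u (limitGraph_adj.2 ⟨n + 1, stageAfter_succ_adj.2 (Or.inr ⟨h1, h2⟩)⟩)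
    have hle := hf3 (f u) u u.2.1 (hf1 u).symm fun h => hf2 u h.symm
    rw [dist_comm (u : E)]
    exact lt_of_le_of_ne hle (hties _ (f u).2.1.1 _ (f (f u)).2.1.1 _ u.2.1.1 (hf1 (f u)).symm
      (hf1 u) hne)
  have hUempty : U = ∅ := by
    rw [Set.eq_empty_iff_forall_notMem]
    intro u hu
    have hsucc : ∀ i, f^[i + 1] ⟨u, hu⟩ = f (f^[i] ⟨u, hu⟩) := fun i =>
      Function.iterate_succ_apply' f i _
    have hanti : StrictAnti fun i : ℕ => dist (f^[i] ⟨u, hu⟩ : E) (f (f^[i] ⟨u, hu⟩)) := by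
      refine strictAnti_nat_of_succ_lt fun i => ?_
      rw [hsucc]
      exact hdec _
    refine hchain ⟨fun i => (f^[i] ⟨u, hu⟩ : U), fun i j hij => hanti.injective ?_,
      fun i => (f^[i] ⟨u, hu⟩).2.1.1, ?_⟩
    · have : f^[i] ⟨u, hu⟩ = f^[j] ⟨u, hu⟩ := Subtype.ext hij
      simp only [this]
    · simpa only [hsucc] using hanti
  rcases (unexhausted S D).eq_empty_or_nonempty with h | ⟨u, hu⟩
  · rw [h]; exact Set.finite_empty
  refine ((finite_neighborSet_limitGraph (S := S) (D := D) u).insert u).subset fun v hv => ?_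
  by_contra hcon
  simp only [Set.mem_insert_iff, SimpleGraph.mem_neighborSet, not_or] at hcon
  exact Set.eq_empty_iff_forall_notMem.1 hUempty u ⟨hu, v, hv, hcon.1, hcon.2⟩

end Procedure

/-! ### Paths in the Poisson process -/

section Cells

variable {E : Type*} [MetricSpace E] [SecondCountableTopology E] [Nonempty E]

/-- A partition of the space, indexed by `ℕ`, into sets of diameter at most `2 * ε`. -/
def cell (E : Type*) [MetricSpace E] [SecondCountableTopology E] [Nonempty E] (ε : ℝ) (i : ℕ) :
    Set E :=
  disjointed (fun i => Metric.ball (TopologicalSpace.denseSeq E i) ε) i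

theorem disjoint_cell {ε : ℝ} : Pairwise (Function.onFun Disjoint (cell E ε)) :=
  disjoint_disjointed _

theorem exists_mem_cell {ε : ℝ} (hε : 0 < ε) (x : E) : ∃ i, x ∈ cell E ε i := by
  have : x ∈ ⋃ i, cell E ε i := by
    rw [show ⋃ i, cell E ε i = ⋃ i, Metric.ball (TopologicalSpace.denseSeq E i) ε from
      iUnion_disjointed]
    obtain ⟨i, hy⟩ := (TopologicalSpace.denseRange_denseSeq E).exists_dist_lt x hε
    exact Set.mem_iUnion.2 ⟨_, hy⟩
  exact Set.mem_iUnion.1 this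

theorem dist_lt_of_mem_cell {ε : ℝ} {i : ℕ} {x y : E} (hx : x ∈ cell E ε i)
    (hy : y ∈ cell E ε i) : dist x y < 2 * ε := by
  have h1 : dist x (TopologicalSpace.denseSeq E i) < ε :=
    Metric.mem_ball.1
      (disjointed_subset (fun i => Metric.ball (TopologicalSpace.denseSeq E i) ε) _ hx)
  have h2 : dist y (TopologicalSpace.denseSeq E i) < ε :=
    Metric.mem_ball.1
      (disjointed_subset (fun i => Metric.ball (TopologicalSpace.denseSeq E i) ε) _ hy)
  have := dist_triangle_right x y (TopologicalSpace.denseSeq E i)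
  linarith

theorem measurableSet_cell [MeasurableSpace E] [OpensMeasurableSpace E] (ε : ℝ) (i : ℕ) :
    MeasurableSet (cell E ε i) :=
  MeasurableSet.disjointed (fun _ => Metric.isOpen_ball.measurableSet) i

/-- The cells `i` and `j` contain points at a distance in `[a, b)`. -/
def CellStep (E : Type*) [MetricSpace E] [SecondCountableTopology E] [Nonempty E]
    (ε a b : ℝ) (i j : ℕ) : Prop :=
  ∃ x ∈ cell E ε i, ∃ y ∈ cell E ε j, a ≤ dist x y ∧ dist x y < b

/-- A path of cells that starts at a cell meeting the ball `ball c ρ`. -/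
def CellPath (ε : ℝ) (c : E) (ρ a b : ℝ) {n : ℕ} (p : Fin (n + 1) → ℕ) : Prop :=
  (∃ x ∈ cell E ε (p 0), x ∈ Metric.ball c ρ) ∧
    ∀ i : Fin n, CellStep E ε a b (p i.castSucc) (p i.succ)

variable [MeasurableSpace E] [OpensMeasurableSpace E]

open Classical in
theorem tsum_cell_le (ν : Measure E) {ε : ℝ} {J : ℕ → Prop} {T : Set E}
    (h : ∀ i, J i → cell E ε i ⊆ T) :
    ∑' i, (if J i then ν (cell E ε i) else 0) ≤ ν T := by
  have heq : ∀ i, (if J i then ν (cell E ε i) else 0) = ν (if J i then cell E ε i else ∅) := by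
    intro i; split_ifs <;> simp
  simp_rw [heq]
  rw [← measure_iUnion]
  · refine measure_mono (Set.iUnion_subset fun i => ?_)
    split_ifs with hi
    · exact h i hi
    · exact Set.empty_subset _
  · intro i j hij
    have := disjoint_cell (E := E) (ε := ε) hij
    simp only [Function.onFun] at this ⊢
    split_ifs <;> simp [this]
  · intro i
    split_ifs
    · exact measurableSet_cell ε i
    · exact MeasurableSet.empty

open Classical in
/-- The total weight of the paths of cells, each weighted by the product of the measures of its
cells: given a cell, the cells that can come next lie in a slightly enlarged shell around it. -/
theorem tsum_cellPath_le (ν : Measure E) {ε ρ a b : ℝ} {c : E} {K : ℝ≥0∞}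
    (hK : ∀ x : E, ν {z | a - 4 * ε ≤ dist x z ∧ dist x z < b + 4 * ε} ≤ K) (n : ℕ) :
    ∑' p : Fin (n + 1) → ℕ, (if CellPath ε c ρ a b p then ∏ i, ν (cell E ε (p i)) else 0) ≤
      ν (Metric.ball c (ρ + 2 * ε)) * K ^ n := by
  induction n with
  | zero =>
    rw [← (Equiv.funUnique (Fin 1) ℕ).symm.tsum_eq]
    simp only [Nat.reduceAdd, Finset.univ_unique, Fin.default_eq_zero, Finset.prod_singleton,
      pow_zero, mul_one]
    refine tsum_cell_le ν fun i hi x hx => ?_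
    obtain ⟨⟨y, hy, hyc⟩, -⟩ := hi
    have h1 := dist_lt_of_mem_cell hx hy
    have h2 := dist_triangle x y c
    rw [Metric.mem_ball] at hyc ⊢
    linarith
  | succ n ih =>
    rw [← (Fin.snocEquiv fun _ : Fin (n + 2) => ℕ).tsum_eq]
    have hle : ∀ q : ℕ × (Fin (n + 1) → ℕ),
        (if CellPath ε c ρ a b (Fin.snocEquiv (fun _ : Fin (n + 2) => ℕ) q) then
          ∏ i, ν (cell E ε (Fin.snocEquiv (fun _ : Fin (n + 2) => ℕ) q i)) else 0) ≤
        (if CellPath ε c ρ a b q.2 then ∏ i, ν (cell E ε (q.2 i)) else 0) *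
          (if CellStep E ε a b (q.2 (Fin.last n)) q.1 then ν (cell E ε q.1) else 0) := by
      rintro ⟨j, p⟩
      have hprefix : CellPath ε c ρ a b (Fin.snocEquiv (fun _ : Fin (n + 2) => ℕ) (j, p)) →
          CellPath ε c ρ a b p := by
        refine fun h => ⟨?_, fun i => ?_⟩
        · have := h.1
          rw [← Fin.castSucc_zero] at this
          simpa only [Fin.snocEquiv, Equiv.coe_fn_mk, Fin.snoc_castSucc] using this
        · have := h.2 i.castSucc
          rw [← Fin.castSucc_succ] at this
          simpa only [Fin.snocEquiv, Equiv.coe_fn_mk, Fin.snoc_castSucc] using this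
      by_cases h1 : CellPath ε c ρ a b (Fin.snocEquiv (fun _ : Fin (n + 2) => ℕ) (j, p))
      · have h3 : CellStep E ε a b (p (Fin.last n)) j := by
          simpa [Fin.snocEquiv] using h1.2 (Fin.last n)
        rw [if_pos h1, if_pos (hprefix h1), if_pos h3]
        simp [Fin.prod_univ_castSucc, Fin.snocEquiv]
      · rw [if_neg h1]
        exact zero_le
    refine (ENNReal.tsum_le_tsum hle).trans ?_
    rw [← (Equiv.prodComm (Fin (n + 1) → ℕ) ℕ).tsum_eq]
    refine (le_of_eq (ENNReal.tsum_prod (f := fun (p : Fin (n + 1) → ℕ) (j : ℕ) =>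
      (if CellPath ε c ρ a b p then ∏ i, ν (cell E ε (p i)) else 0) *
          (if CellStep E ε a b (p (Fin.last n)) j then ν (cell E ε j) else 0)))).trans ?_
    simp_rw [ENNReal.tsum_mul_left]
    rw [pow_succ, ← mul_assoc]
    refine le_trans ?_ (mul_le_mul_left ih K)
    rw [← ENNReal.tsum_mul_right]
    refine ENNReal.tsum_le_tsum fun p => mul_le_mul_right ?_ _
    rcases (cell E ε (p (Fin.last n))).eq_empty_or_nonempty with hempty | ⟨x, hx⟩
    · simp [CellStep, hempty]
    · refine (tsum_cell_le ν fun j hj z hz => ?_).trans (hK x)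
      obtain ⟨u, hu, v, hv, h1, h2⟩ := hj
      have h3 := dist_lt_of_mem_cell hx hu
      have h4 := dist_lt_of_mem_cell hv hz
      have h5 := dist_triangle4 x u v z
      have h6 := dist_triangle4 u x z v
      rw [dist_comm u x, dist_comm z v] at h6
      constructor <;> linarith

end Cells

section Poisson

variable {d : ℕ} {Ω : Type*} [MeasurableSpace Ω] {Pr : Measure Ω}
  {P : Ω → Measure (EuclideanSpace ℝ (Fin d))}

theorem IsPoissonProcess.measurable_apply (hP : IsPoissonProcess Pr P)
    {B : Set (EuclideanSpace ℝ (Fin d))} (hB : MeasurableSet B) : Measurable fun ω => P ω B :=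
  (Measure.measurable_coe hB).comp hP.isPointProcess.measurable

/-- The probability that a set is occupied is at most its volume, as `1 - exp (-v) ≤ v`. -/
theorem IsPoissonProcess.measure_ne_zero_le (hP : IsPoissonProcess Pr P)
    {B : Set (EuclideanSpace ℝ (Fin d))} (hB : MeasurableSet B) :
    Pr {ω | P ω B ≠ 0} ≤ volume B := by
  by_cases hfin : volume B = ∞
  · rw [hfin]; exact le_top
  have h : Pr {ω | P ω B ≠ 0} = Pr.map (fun ω => P ω B) {0}ᶜ := by
    rw [Measure.map_apply (hP.measurable_apply hB) (measurableSet_singleton 0).compl]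
    rfl
  have hpre : (fun n : ℕ => (n : ℝ≥0∞)) ⁻¹' {0}ᶜ = {0}ᶜ := by ext; simp
  rw [h, hP.count_law B hB hfin, Measure.map_apply (by fun_prop)
    (measurableSet_singleton 0).compl, hpre, prob_compl_eq_one_sub (measurableSet_singleton 0),
    poissonMeasure_singleton]
  simp only [pow_zero, mul_one, Nat.factorial_zero, Nat.cast_one, div_one]
  rw [← ENNReal.ofReal_one, ← ENNReal.ofReal_sub _ (Real.exp_pos _).le]
  refine ENNReal.ofReal_le_of_le_toReal ?_
  have := Real.one_sub_le_exp_neg ((volume B).toNNReal : ℝ)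
  rw [ENNReal.coe_toNNReal_eq_toReal] at *
  linarith

theorem IsPoissonProcess.measure_cells_ne_zero_le (hP : IsPoissonProcess Pr P) {ε : ℝ} {n : ℕ}
    {p : Fin n → ℕ} (hp : p.Injective) :
    Pr {ω | ∀ i, P ω (cell (EuclideanSpace ℝ (Fin d)) ε (p i)) ≠ 0} ≤
      ∏ i, volume (cell (EuclideanSpace ℝ (Fin d)) ε (p i)) := by
  have hind := hP.count_indep n (fun i => cell _ ε (p i)) (fun i => measurableSet_cell ε _)
    fun i j hij => disjoint_cell (hp.ne hij)
  have := hind.measure_inter_preimage_eq_mul Finset.univ (sets := fun _ => {0}ᶜ)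
    fun _ _ => (measurableSet_singleton 0).compl
  have hset : {ω | ∀ i, P ω (cell (EuclideanSpace ℝ (Fin d)) ε (p i)) ≠ 0} =
      ⋂ i ∈ Finset.univ, (fun ω => P ω (cell (EuclideanSpace ℝ (Fin d)) ε (p i))) ⁻¹' {0}ᶜ := by
    ext; simp
  rw [hset, this]
  exact Finset.prod_le_prod' fun i _ => hP.measure_ne_zero_le (measurableSet_cell ε _)

theorem IsPoissonProcess.measure_exists_cellPath_le (hP : IsPoissonProcess Pr P)
    {ε ρ a b : ℝ} {c : EuclideanSpace ℝ (Fin d)} {K : ℝ≥0∞}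
    (hK : ∀ x : EuclideanSpace ℝ (Fin d),
      volume {z | a - 4 * ε ≤ dist x z ∧ dist x z < b + 4 * ε} ≤ K) (n : ℕ) :
    Pr {ω | ∃ p : Fin (n + 1) → ℕ, p.Injective ∧ CellPath ε c ρ a b p ∧
        ∀ i, P ω (cell _ ε (p i)) ≠ 0} ≤
      volume (Metric.ball c (ρ + 2 * ε)) * K ^ n := by
  classical
  refine le_trans ?_ (tsum_cellPath_le volume hK n)
  rw [Set.ofPred_exists]
  refine (measure_iUnion_le _).trans (ENNReal.tsum_le_tsum fun p => ?_)
  by_cases h : p.Injective ∧ CellPath ε c ρ a b p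
  · rw [if_pos h.2]
    exact (measure_mono fun ω hω => hω.2.2).trans (hP.measure_cells_ne_zero_le h.1)
  · have : {ω | p.Injective ∧ CellPath ε c ρ a b p ∧ ∀ i, P ω (cell _ ε (p i)) ≠ 0} = ∅ :=
      Set.eq_empty_of_forall_notMem fun ω hω => h ⟨hω.1, hω.2.1⟩
    rw [this, measure_empty]
    exact zero_le

/-- The (outer) probability of a path of `n` steps through distinct points of the Poisson process,
with all steps of length in `[a, b)`.  As the mesh of the partition into cells tends to zero, such a
path visits distinct cells, and disjoint cells are independently occupied. -/
theorem IsPoissonProcess.measure_exists_path_le (hP : IsPoissonProcess Pr P)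
    {ρ a b δ : ℝ} (hδ : 0 < δ) (hδ' : δ ≤ 1) {c : EuclideanSpace ℝ (Fin d)} {K : ℝ≥0∞}
    (hK : ∀ x : EuclideanSpace ℝ (Fin d),
      volume {z | a - δ ≤ dist x z ∧ dist x z < b + δ} ≤ K) (n : ℕ) :
    Pr {ω | ∃ x : Fin (n + 1) → EuclideanSpace ℝ (Fin d), x.Injective ∧
        (∀ i, x i ∈ pointSet (P ω)) ∧ x 0 ∈ Metric.ball c ρ ∧
        ∀ i : Fin n, a ≤ dist (x i.castSucc) (x i.succ) ∧ dist (x i.castSucc) (x i.succ) < b} ≤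
      volume (Metric.ball c (ρ + 1)) * K ^ n := by
  set F : ℕ → Set Ω := fun m => {ω | ∃ p : Fin (n + 1) → ℕ, p.Injective ∧
    CellPath (1 / ((m : ℝ) + 1)) c ρ a b p ∧
      ∀ i, P ω (cell _ (1 / ((m : ℝ) + 1)) (p i)) ≠ 0} with hF
  have hlim : Filter.Tendsto (fun m : ℕ => 1 / ((m : ℝ) + 1)) Filter.atTop (nhds 0) :=
    tendsto_one_div_add_atTop_nhds_zero_nat
  have hFle : ∀ᶠ m in Filter.atTop, Pr (F m) ≤ volume (Metric.ball c (ρ + 1)) * K ^ n := by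
    filter_upwards [hlim.eventually (gt_mem_nhds (show (0 : ℝ) < δ / 4 by linarith))] with m hm
    refine (hP.measure_exists_cellPath_le (K := K) (fun x => ?_) n).trans ?_
    · refine (measure_mono fun z hz => ?_).trans (hK x)
      have h1 := hz.1
      have h2 := hz.2
      constructor <;> linarith
    · gcongr
      linarith
  have hsub : {ω | ∃ x : Fin (n + 1) → EuclideanSpace ℝ (Fin d), x.Injective ∧
        (∀ i, x i ∈ pointSet (P ω)) ∧ x 0 ∈ Metric.ball c ρ ∧
        ∀ i : Fin n, a ≤ dist (x i.castSucc) (x i.succ) ∧ dist (x i.castSucc) (x i.succ) < b} ⊆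
      ⋃ k, ⋂ m ≥ k, F m := by
    rintro ω ⟨x, hinj, hmem, hball, hstep⟩
    have hsep : ∀ᶠ m : ℕ in Filter.atTop, ∀ i j, i ≠ j →
        2 * (1 / ((m : ℝ) + 1)) < dist (x i) (x j) := by
      refine Filter.eventually_all.2 fun i => Filter.eventually_all.2 fun j => ?_
      by_cases hij : i = j
      · exact Filter.Eventually.of_forall fun m h => absurd hij h
      · have hpos : 0 < dist (x i) (x j) / 2 := half_pos (dist_pos.2 (hinj.ne hij))
        filter_upwards [hlim.eventually (gt_mem_nhds hpos)] with m hm _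
        linarith
    obtain ⟨k, hk⟩ := Filter.eventually_atTop.1 hsep
    refine Set.mem_iUnion.2 ⟨k, Set.mem_iInter₂.2 fun m hm => ?_⟩
    have hε : (0 : ℝ) < 1 / ((m : ℝ) + 1) := by positivity
    choose p hp using fun i => exists_mem_cell hε (x i)
    refine ⟨p, fun i j hij => ?_, ⟨⟨x 0, hp 0, hball⟩, fun i => ⟨_, hp _, _, hp _, hstep i⟩⟩,
      fun i h0 => ?_⟩
    · by_contra hne
      have h1 := dist_lt_of_mem_cell (hp i) (hij ▸ hp j)
      exact absurd (hk m hm i j hne) (not_lt.2 h1.le)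
    · exact (hmem i).ne' (measure_mono_null (Set.singleton_subset_iff.2 (hp i)) h0)
  refine (measure_mono hsub).trans ?_
  rw [Monotone.measure_iUnion]
  · refine iSup_le fun k => ?_
    obtain ⟨m, hm⟩ := (hFle.and (Filter.eventually_ge_atTop k)).exists
    exact (measure_mono (Set.iInter₂_subset m hm.2)).trans hm.1
  · exact fun i j hij => Set.biInter_mono (fun m (hm : m ≥ j) => hij.trans hm) fun _ _ => le_rfl

/-- Shells of bounded radius have volume at most a constant times their width. -/
theorem exists_volume_shell_le (hd : 1 ≤ d) {R : ℝ} (hR : 0 ≤ R) :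
    ∃ C : ℝ, 0 ≤ C ∧ ∀ (x : EuclideanSpace ℝ (Fin d)) (a b : ℝ), a ≤ b → b ≤ R →
      volume {z | a ≤ dist x z ∧ dist x z < b} ≤ ENNReal.ofReal (C * (b - a)) := by
  have : Nonempty (Fin d) := ⟨⟨0, hd⟩⟩
  set V := volume (Metric.ball (0 : EuclideanSpace ℝ (Fin d)) 1) with hV
  have hVfin : V ≠ ∞ := measure_ball_lt_top.ne
  refine ⟨d * R ^ (d - 1) * V.toReal, by positivity, fun x a b hab hb => ?_⟩
  have hsub : {z | a ≤ dist x z ∧ dist x z < b} ⊆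
      Metric.ball x (max b 0) \ Metric.ball x (max a 0) := by
    intro z hz
    rw [Set.mem_sdiff, Metric.mem_ball, Metric.mem_ball, dist_comm, not_lt]
    exact ⟨hz.2.trans_le (le_max_left _ _), max_le hz.1 dist_nonneg⟩
  refine (measure_mono hsub).trans ?_
  have ha0 : 0 ≤ max a 0 := le_max_right _ _
  have hb0 : 0 ≤ max b 0 := le_max_right _ _
  have hmax : max a 0 ≤ max b 0 := max_le_max hab le_rfl
  rw [measure_sdiff (Metric.ball_subset_ball hmax) Metric.isOpen_ball.nullMeasurableSet
    measure_ball_lt_top.ne, Measure.addHaar_ball _ _ ha0, Measure.addHaar_ball _ _ hb0, ← hV,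
    finrank_euclideanSpace_fin, ← ENNReal.sub_mul (fun _ _ => hVfin),
    ← ENNReal.ofReal_sub _ (pow_nonneg ha0 d), ← ENNReal.ofReal_toReal hVfin,
    ← ENNReal.ofReal_mul' ENNReal.toReal_nonneg, ENNReal.toReal_ofReal ENNReal.toReal_nonneg]
  refine ENNReal.ofReal_le_ofReal ?_
  have h1 := (le_abs_self _).trans (abs_pow_sub_pow_le (max b 0) (max a 0) d)
  have h2 : |max b 0 - max a 0| ≤ b - a := by
    rw [abs_of_nonneg (sub_nonneg.2 hmax)]
    rcases le_total a 0 with h | h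
    · rcases le_total b 0 with h' | h'
      · rw [max_eq_right h, max_eq_right h']; linarith
      · rw [max_eq_right h, max_eq_left h']; linarith
    · rw [max_eq_left h, max_eq_left (h.trans hab)]
  have h3 : max |max b 0| |max a 0| ≤ R := by
    rw [abs_of_nonneg ha0, abs_of_nonneg hb0, max_eq_left hmax]
    exact max_le hb hR
  have h4 : max |max b 0| |max a 0| ^ (d - 1) ≤ R ^ (d - 1) :=
    pow_le_pow_left₀ (le_max_of_le_left (abs_nonneg _)) h3 _
  calc (max b 0 ^ d - max a 0 ^ d) * V.toReal
      ≤ ((b - a) * d * R ^ (d - 1)) * V.toReal := by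
        refine mul_le_mul_of_nonneg_right (h1.trans ?_) ENNReal.toReal_nonneg
        have : 0 ≤ b - a := sub_nonneg.2 hab
        gcongr
    _ = d * R ^ (d - 1) * V.toReal * (b - a) := by ring

end Poisson

section Poisson

variable {d : ℕ} {Ω : Type*} [MeasurableSpace Ω] {Pr : Measure Ω}
  {P : Ω → Measure (EuclideanSpace ℝ (Fin d))}

/-- Two points `y, z` at the same distance from `x` give a path `y, x, z` of two steps in a common
thin shell.  There are `O(N)` shells of width `1 / N` to consider, and each contributes
`O(1 / N ^ 2)`. -/
theorem IsPoissonProcess.ae_hasNoTies (hd : 1 ≤ d) (hP : IsPoissonProcess Pr P) :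
    ∀ᵐ ω ∂Pr, HasNoTies (pointSet (P ω)) := by
  have main : ∀ R : ℕ, Pr {ω | ∃ x ∈ pointSet (P ω), ∃ y ∈ pointSet (P ω), ∃ z ∈ pointSet (P ω),
      x ≠ y ∧ x ≠ z ∧ y ≠ z ∧ dist x y = dist x z ∧ y ∈ Metric.ball 0 (R : ℝ) ∧
        dist x y < R} = 0 := by
    intro R
    obtain ⟨C, hC0, hC⟩ := exists_volume_shell_le (d := d) hd
      (show (0 : ℝ) ≤ R + 2 by positivity)
    set V := volume (Metric.ball (0 : EuclideanSpace ℝ (Fin d)) (R + 1)) with hV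
    have hVfin : V ≠ ∞ := measure_ball_lt_top.ne
    have hlim : Filter.Tendsto
        (fun n : ℕ => V * ENNReal.ofReal (R * (9 * C ^ 2) * (1 / ((n : ℝ) + 1)))) Filter.atTop
        (nhds 0) := by
      have h1 : Filter.Tendsto (fun n : ℕ => R * (9 * C ^ 2) * (1 / ((n : ℝ) + 1))) Filter.atTop
          (nhds (R * (9 * C ^ 2) * 0)) :=
        tendsto_one_div_add_atTop_nhds_zero_nat.const_mul _
      have h2 := ENNReal.Tendsto.const_mul (ENNReal.tendsto_ofReal h1) (Or.inr hVfin)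
      simpa using h2
    refine le_antisymm (ge_of_tendsto' hlim fun n => ?_) zero_le
    have hh : (0 : ℝ) < 1 / ((n : ℝ) + 1) := by positivity
    have hh1 : 1 / ((n : ℝ) + 1) ≤ 1 := by
      rw [div_le_one (by positivity)]; linarith [(Nat.cast_nonneg n : (0 : ℝ) ≤ n)]
    set h : ℝ := 1 / ((n : ℝ) + 1) with hdef
    have hmul : ((n : ℝ) + 1) * h = 1 := by rw [hdef]; field_simp
    have hsub : {ω | ∃ x ∈ pointSet (P ω), ∃ y ∈ pointSet (P ω), ∃ z ∈ pointSet (P ω),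
        x ≠ y ∧ x ≠ z ∧ y ≠ z ∧ dist x y = dist x z ∧ y ∈ Metric.ball 0 (R : ℝ) ∧
          dist x y < R} ⊆ ⋃ j ∈ Finset.range (R * (n + 1)),
        {ω | ∃ x : Fin (2 + 1) → EuclideanSpace ℝ (Fin d), x.Injective ∧
          (∀ i, x i ∈ pointSet (P ω)) ∧ x 0 ∈ Metric.ball 0 (R : ℝ) ∧
          ∀ i : Fin 2, j * h ≤ dist (x i.castSucc) (x i.succ) ∧
            dist (x i.castSucc) (x i.succ) < (j + 1) * h} := by
      rintro ω ⟨x, hx, y, hy, z, hz, hxy, hxz, hyz, heq, hball, hlt⟩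
      have hfl1 := Nat.floor_le (show 0 ≤ dist x y / h by positivity)
      have hfl2 := Nat.lt_floor_add_one (dist x y / h)
      rw [le_div_iff₀ hh] at hfl1
      rw [div_lt_iff₀ hh] at hfl2
      refine Set.mem_iUnion₂.2 ⟨⌊dist x y / h⌋₊, Finset.mem_range.2 ?_, ![y, x, z], ?_, ?_,
        hball, ?_⟩
      · rw [Nat.floor_lt (by positivity), div_lt_iff₀ hh]
        push_cast
        rwa [mul_assoc, hmul, mul_one]
      · intro i j hij
        fin_cases i <;> fin_cases j <;> simp_all
      · intro i
        fin_cases i <;> assumption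
      · intro i
        fin_cases i
        · simpa [dist_comm y x] using ⟨hfl1, hfl2⟩
        · rw [heq] at hfl1 hfl2
          simpa [heq] using ⟨hfl1, hfl2⟩
    refine (measure_mono hsub).trans ((measure_biUnion_finset_le _ _).trans ?_)
    have hterm : ∀ j ∈ Finset.range (R * (n + 1)),
        Pr {ω | ∃ x : Fin (2 + 1) → EuclideanSpace ℝ (Fin d), x.Injective ∧
          (∀ i, x i ∈ pointSet (P ω)) ∧ x 0 ∈ Metric.ball 0 (R : ℝ) ∧
          ∀ i : Fin 2, j * h ≤ dist (x i.castSucc) (x i.succ) ∧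
            dist (x i.castSucc) (x i.succ) < (j + 1) * h} ≤
          V * ENNReal.ofReal (C * (3 * h)) ^ 2 := by
      intro j hj
      refine hP.measure_exists_path_le hh hh1 (fun x => ?_) 2
      have hjR : (j : ℝ) * h ≤ R := by
        have : (j : ℝ) ≤ R * (n + 1) := by exact_mod_cast (Finset.mem_range.1 hj).le
        calc (j : ℝ) * h ≤ R * (n + 1) * h := by gcongr
          _ = R := by rw [mul_assoc, hmul, mul_one]
      refine (hC x _ _ (by linarith) (by linarith)).trans (le_of_eq ?_)
      congr 2
      ring
    refine (Finset.sum_le_sum hterm).trans (le_of_eq ?_)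
    rw [Finset.sum_const, Finset.card_range, nsmul_eq_mul, mul_left_comm]
    congr 1
    rw [← ENNReal.ofReal_natCast, ← ENNReal.ofReal_pow (by positivity),
      ← ENNReal.ofReal_mul (by positivity)]
    congr 1
    push_cast
    calc (R : ℝ) * (n + 1) * (C * (3 * h)) ^ 2 = R * (9 * C ^ 2) * h * ((n + 1) * h) := by ring
      _ = R * (9 * C ^ 2) * h := by rw [hmul, mul_one]
  have hall := ae_all_iff.2 fun R : ℕ => (measure_eq_zero_iff_ae_notMem.1 (main R))
  filter_upwards [hall] with ω hω x hx y hy z hz hxy hxz hyz heq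
  obtain ⟨R, hR⟩ := exists_nat_gt (max ‖y‖ (dist x y))
  exact hω R ⟨x, hx, y, hy, z, hz, hxy, hxz, hyz, heq,
    mem_ball_zero_iff.2 ((le_max_left _ _).trans_lt hR), (le_max_right _ _).trans_lt hR⟩

/-- The step lengths of a descending chain converge from above, so they eventually lie in one of
countably many shells whose volume, slightly enlarged, is at most `1 / 2`; long paths with steps in
such a shell are exponentially unlikely. -/
theorem IsPoissonProcess.ae_hasNoDescendingChain (hd : 1 ≤ d) (hP : IsPoissonProcess Pr P) :
    ∀ᵐ ω ∂Pr, HasNoDescendingChain (pointSet (P ω)) := by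
  choose C hC0 hC using fun R : ℕ => exists_volume_shell_le (d := d) hd
      (show (0 : ℝ) ≤ R + 2 by positivity)
  -- shells of width `h R`, enlarged by `h R` on both sides, have volume at most `1 / 2`
  set h : ℕ → ℝ := fun R => 1 / (6 * (C R + 1)) with hdef
  have hh : ∀ R, 0 < h R := fun R => by have := hC0 R; simp only [hdef]; positivity
  have hh1 : ∀ R, h R ≤ 1 := fun R => by
    have := hC0 R
    simp only [hdef]
    rw [div_le_one (by positivity)]
    linarith
  have hCh : ∀ R, C R * (3 * h R) ≤ 1 / 2 := fun R => by
    have := hC0 R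
    have : C R * (3 * h R) = C R / (C R + 1) * (1 / 2) := by
      simp only [hdef]; field_simp; ring
    rw [this]
    have : C R / (C R + 1) ≤ 1 := by rw [div_le_one (by positivity)]; linarith
    linarith
  have main : ∀ R j k : ℕ, j * h R ≤ R → Pr {ω | ∃ c : ℕ → EuclideanSpace ℝ (Fin d),
      c.Injective ∧ (∀ i, c i ∈ pointSet (P ω)) ∧ c 0 ∈ Metric.ball 0 (k : ℝ) ∧
        ∀ i, j * h R ≤ dist (c i) (c (i + 1)) ∧ dist (c i) (c (i + 1)) < (j + 1) * h R} = 0 := by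
    intro R j k hj
    set V := volume (Metric.ball (0 : EuclideanSpace ℝ (Fin d)) (k + 1)) with hV
    have hVfin : V ≠ ∞ := measure_ball_lt_top.ne
    have hlim : Filter.Tendsto (fun n : ℕ => V * (1 / 2 : ℝ≥0∞) ^ n) Filter.atTop (nhds 0) := by
      have h1 : (1 / 2 : ℝ≥0∞) < 1 := by simp
      have h2 := ENNReal.Tendsto.const_mul (ENNReal.tendsto_pow_atTop_nhds_zero_of_lt_one h1)
        (Or.inr hVfin)
      simpa using h2
    refine le_antisymm (ge_of_tendsto' hlim fun n => ?_) zero_le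
    refine le_trans (measure_mono ?_) (hP.measure_exists_path_le (a := j * h R)
      (b := (j + 1) * h R) (ρ := k) (hh R) (hh1 R) (c := 0) (fun x => ?_) n)
    · rintro ω ⟨c, hinj, hmem, hball, hstep⟩
      exact ⟨fun i => c i, fun i j hij => Fin.ext (hinj hij), fun i => hmem i, hball,
        fun i => by simpa using hstep i⟩
    · have h1 := hh R
      have h2 := hh1 R
      refine (hC R x _ _ (by linarith) (by linarith)).trans ?_
      have : C R * ((j + 1) * h R + h R - (j * h R - h R)) = C R * (3 * h R) := by ring
      rw [this]
      refine (ENNReal.ofReal_le_ofReal (hCh R)).trans (le_of_eq ?_)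
      rw [ENNReal.ofReal_div_of_pos (by norm_num)]
      simp
  have hall : ∀ᵐ ω ∂Pr, ∀ R j k : ℕ, j * h R ≤ R → ¬ ∃ c : ℕ → EuclideanSpace ℝ (Fin d),
      c.Injective ∧ (∀ i, c i ∈ pointSet (P ω)) ∧ c 0 ∈ Metric.ball 0 (k : ℝ) ∧
        ∀ i, j * h R ≤ dist (c i) (c (i + 1)) ∧ dist (c i) (c (i + 1)) < (j + 1) * h R := by
    refine ae_all_iff.2 fun R => ae_all_iff.2 fun j => ae_all_iff.2 fun k => ?_
    by_cases hj : j * h R ≤ R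
    · filter_upwards [measure_eq_zero_iff_ae_notMem.1 (main R j k hj)] with ω hω _
      exact hω
    · exact Filter.Eventually.of_forall fun ω h => absurd h hj
  filter_upwards [hall] with ω hω
  rintro ⟨c, hinj, hmem, hanti⟩
  have hbdd : BddBelow (Set.range fun i => dist (c i) (c (i + 1))) :=
    ⟨0, by rintro _ ⟨i, rfl⟩; exact dist_nonneg⟩
  have hlim := tendsto_atTop_ciInf hanti.antitone hbdd
  set r := ⨅ i, dist (c i) (c (i + 1)) with hr
  have hr0 : 0 ≤ r := le_ciInf fun i => dist_nonneg
  obtain ⟨R, hR⟩ := exists_nat_gt r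
  have hfl1 := Nat.floor_le (show 0 ≤ r / h R from div_nonneg hr0 (hh R).le)
  have hfl2 := Nat.lt_floor_add_one (r / h R)
  rw [le_div_iff₀ (hh R)] at hfl1
  rw [div_lt_iff₀ (hh R)] at hfl2
  obtain ⟨i, hi⟩ := (hlim.eventually (gt_mem_nhds hfl2)).exists
  obtain ⟨k, hk⟩ := exists_nat_gt ‖c i‖
  refine hω R ⌊r / h R⌋₊ k (hfl1.trans hR.le) ⟨fun m => c (i + m),
    fun m n hmn => add_left_cancel (hinj hmn), fun m => hmem _, ?_, fun m => ⟨?_, ?_⟩⟩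
  · exact mem_ball_zero_iff.2 hk
  · exact hfl1.trans (ciInf_le hbdd (i + m))
  · exact (hanti.antitone (Nat.le_add_right i m)).trans_lt hi

end Poisson

/-! ### Point measures and measurable enumerations of their points -/

/-- The random set `S` is enumerated, without repetition, by the random points `X k`, the `k`-th of
which is present on the event `V k`. -/
structure IsEnumeration {α E : Type*} [MeasurableSpace α] [MeasurableSpace E] (S : α → Set E)
    (V : ℕ → Set α) (X : ℕ → α → E) : Prop where
  measurableSet : ∀ k, MeasurableSet (V k)
  measurable : ∀ k, Measurable (X k)
  mem_iff : ∀ a x, x ∈ S a ↔ ∃ k, a ∈ V k ∧ X k a = x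
  inj : ∀ a k l, a ∈ V k → a ∈ V l → X k a = X l a → k = l

theorem IsEnumeration.comp {α β E : Type*} [MeasurableSpace α] [MeasurableSpace β]
    [MeasurableSpace E] {S : α → Set E}
    {V : ℕ → Set α} {X : ℕ → α → E} (h : IsEnumeration S V X) {f : β → α} (hf : Measurable f) :
    IsEnumeration (fun b => S (f b)) (fun k => f ⁻¹' V k) (fun k b => X k (f b)) where
  measurableSet k := hf (h.measurableSet k)
  measurable k := (h.measurable k).comp hf
  mem_iff _ _ := h.mem_iff _ _
  inj _ _ _ hk hl := h.inj _ _ _ hk hl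

section PointMeasures

variable {E : Type*} [MetricSpace E] [MeasurableSpace E]

theorem IsPointMeasure.exists_apply_singleton [MeasurableSingletonClass E] {φ : Measure E}
    (hφ : IsPointMeasure φ) (x : E) : ∃ n : ℕ, φ {x} = n :=
  hφ _ (measurableSet_singleton x) Bornology.isBounded_singleton

theorem IsPointMeasure.tendsto_measure_ball [OpensMeasurableSpace E] {φ : Measure E}
    (hφ : IsPointMeasure φ) (x : E) :
    Filter.Tendsto (fun n : ℕ => φ (Metric.ball x (2 * (1 / ((n : ℝ) + 1))))) Filter.atTop
      (nhds (φ {x})) := by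
  have hlim : Filter.Tendsto (fun n : ℕ => 2 * (1 / ((n : ℝ) + 1))) Filter.atTop (nhds 0) := by
    simpa using (tendsto_one_div_add_atTop_nhds_zero_nat (𝕜 := ℝ)).const_mul 2
  have hset : {x} = ⋂ n : ℕ, Metric.ball x (2 * (1 / ((n : ℝ) + 1))) := by
    ext y
    simp only [Set.mem_singleton_iff, Set.mem_iInter]
    constructor
    · rintro rfl n
      exact Metric.mem_ball_self (by positivity)
    · intro h
      refine dist_le_zero.1 (ge_of_tendsto' hlim fun n => (Metric.mem_ball.1 (h n)).le)
  rw [hset]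
  refine tendsto_measure_iInter_atTop (fun n => Metric.isOpen_ball.nullMeasurableSet)
    (fun m n hmn => Metric.ball_subset_ball ?_) ⟨0, ?_⟩
  · have : (m : ℝ) ≤ n := by exact_mod_cast hmn
    gcongr
  · obtain ⟨k, hk⟩ := hφ _ Metric.isOpen_ball.measurableSet
      (Metric.isBounded_ball (x := x) (r := 2 * (1 / (((0 : ℕ) : ℝ) + 1))))
    rw [hk]
    exact ENNReal.natCast_ne_top k

/-- A point measure that charges a bounded set has an atom there: otherwise every point of the set
has a ball of measure less than `1`, hence of measure zero. -/
theorem IsPointMeasure.exists_mem_pointSet [OpensMeasurableSpace E] [SecondCountableTopology E]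
    {φ : Measure E} (hφ : IsPointMeasure φ) {B : Set E} (h : φ B ≠ 0) :
    ∃ x ∈ B, x ∈ pointSet φ := by
  by_contra! hcon
  refine h (measure_null_of_locally_null B fun x hx => ?_)
  have h0 : φ {x} = 0 := by simpa [pointSet] using hcon x hx
  have hlim := hφ.tendsto_measure_ball x
  rw [h0] at hlim
  obtain ⟨n, hn⟩ := (hlim.eventually (gt_mem_nhds zero_lt_one)).exists
  refine ⟨Metric.ball x (2 * (1 / ((n : ℝ) + 1))),
    mem_nhdsWithin_of_mem_nhds (Metric.ball_mem_nhds x (by positivity)), ?_⟩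
  obtain ⟨k, hk⟩ := hφ _ Metric.isOpen_ball.measurableSet
    (Metric.isBounded_ball (x := x) (r := 2 * (1 / ((n : ℝ) + 1))))
  rw [hk] at hn ⊢
  have : k < 1 := by exact_mod_cast hn
  simp [Nat.lt_one_iff.1 this]

theorem IsPointMeasure.measure_ne_zero_iff [OpensMeasurableSpace E] [SecondCountableTopology E]
    {φ : Measure E} (hφ : IsPointMeasure φ) {B : Set E} :
    φ B ≠ 0 ↔ ∃ x ∈ B, x ∈ pointSet φ := by
  refine ⟨hφ.exists_mem_pointSet, ?_⟩
  rintro ⟨x, hx, hpos⟩ h0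
  exact hpos.ne' (measure_mono_null (Set.singleton_subset_iff.2 hx) h0)

theorem IsPointMeasure.finite_pointSet_inter_closedBall [OpensMeasurableSpace E] {φ : Measure E}
    (hφ : IsPointMeasure φ) (x : E) (r : ℝ) : (pointSet φ ∩ Metric.closedBall x r).Finite := by
  have hfin : φ (⋃ y : E, {y} ∩ Metric.closedBall x r) ≠ ∞ := by
    rw [← Set.iUnion_inter]
    simp only [Set.iUnion_of_singleton, Set.univ_inter]
    obtain ⟨k, hk⟩ := hφ _ Metric.isClosed_closedBall.measurableSet
      (Metric.isBounded_closedBall (x := x) (r := r))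
    rw [hk]
    exact ENNReal.natCast_ne_top k
  refine (Measure.finite_const_le_meas_of_disjoint_iUnion φ zero_lt_one
    (As := fun y => {y} ∩ Metric.closedBall x r)
    (fun y => (measurableSet_singleton y).inter Metric.isClosed_closedBall.measurableSet) ?_
    hfin).subset ?_
  · intro y z hyz
    exact (Set.disjoint_singleton.2 hyz).mono Set.inter_subset_left Set.inter_subset_left
  · rintro y ⟨hy, hyr⟩
    obtain ⟨k, hk⟩ := hφ.exists_apply_singleton y
    have : 0 < φ {y} := hy
    rw [Set.mem_ofPred_eq, Set.inter_eq_left.2 (Set.singleton_subset_iff.2 hyr), hk]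
    rw [hk] at this
    have : 0 < k := by exact_mod_cast this
    exact_mod_cast this

theorem IsPointMeasure.finite_pointSet_inter [OpensMeasurableSpace E] {φ : Measure E}
    (hφ : IsPointMeasure φ) {B : Set E} (hB : Bornology.IsBounded B) :
    (pointSet φ ∩ B).Finite := by
  rcases B.eq_empty_or_nonempty with rfl | ⟨x, -⟩
  · simp
  · obtain ⟨r, hr⟩ := hB.subset_closedBall x
    exact (hφ.finite_pointSet_inter_closedBall x r).subset (Set.inter_subset_inter_right _ hr)

theorem IsPointMeasure.countable_pointSet [OpensMeasurableSpace E] {φ : Measure E}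
    (hφ : IsPointMeasure φ) : (pointSet φ).Countable := by
  rcases isEmpty_or_nonempty E with hE | ⟨⟨x⟩⟩
  · exact Set.to_countable _
  · have : pointSet φ = ⋃ n : ℕ, pointSet φ ∩ Metric.closedBall x n := by
      rw [← Set.inter_iUnion, Metric.iUnion_closedBall_nat, Set.inter_univ]
    rw [this]
    exact Set.countable_iUnion fun n => (hφ.finite_pointSet_inter_closedBall x n).countable

/-- The value of a random point measure at a random point is measurable: it is the limit of the
values at the cells that contain the point, as the mesh tends to zero. -/
theorem measurable_apply_singleton [OpensMeasurableSpace E] [SecondCountableTopology E]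
    {α : Type*} [MeasurableSpace α] {N : α → Measure E} (hN : Measurable N)
    (hpm : ∀ a, IsPointMeasure (N a)) {X : α → E} (hX : Measurable X) :
    Measurable fun a => N a {X a} := by
  classical
  rcases isEmpty_or_nonempty α with hα | ⟨⟨a₀⟩⟩
  · exact measurable_of_empty _
  have : Nonempty E := ⟨X a₀⟩
  refine measurable_of_tendsto_metrizable (f := fun (n : ℕ) a => ∑' i,
    if X a ∈ cell E (1 / ((n : ℝ) + 1)) i then N a (cell E (1 / ((n : ℝ) + 1)) i) else 0) ?_ ?_
  · intro n
    refine Measurable.tsum fun i => Measurable.ite (hX (measurableSet_cell _ _)) ?_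
      measurable_const
    exact (Measure.measurable_coe (measurableSet_cell _ _)).comp hN
  · refine tendsto_pi_nhds.2 fun a => tendsto_of_tendsto_of_tendsto_of_le_of_le tendsto_const_nhds
      ((hpm a).tendsto_measure_ball (X a)) (fun n => ?_) (fun n => ?_)
    all_goals
      have hε : (0 : ℝ) < 1 / ((n : ℝ) + 1) := by positivity
      obtain ⟨i, hi⟩ := exists_mem_cell hε (X a)
      have hsum : (∑' i, if X a ∈ cell E (1 / ((n : ℝ) + 1)) i then
          N a (cell E (1 / ((n : ℝ) + 1)) i) else 0) = N a (cell E (1 / ((n : ℝ) + 1)) i) := by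
        rw [tsum_eq_single i, if_pos hi]
        intro j hj
        exact if_neg fun h => Set.disjoint_left.1 (disjoint_cell hj) h hi
      simp only [hsum]
    · exact measure_mono (Set.singleton_subset_iff.2 hi)
    · exact measure_mono fun y hy => Metric.mem_ball.2 (dist_lt_of_mem_cell hy hi)

/-- The space of point measures, with the trace of the σ-algebra of `Measure E`. -/
abbrev PointMeasure (E : Type*) [MetricSpace E] [MeasurableSpace E] :=
  {φ : Measure E // IsPointMeasure φ}

theorem measurable_pointMeasure_apply {B : Set E} (hB : MeasurableSet B) :
    Measurable fun φ : PointMeasure E => (φ : Measure E) B :=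
  (Measure.measurable_coe hB).comp measurable_subtype_coe

/-- The points of a point measure can be enumerated measurably.  For each ball of a countable basis
that contains exactly one point of the measure, that point is a measurable function of the measure;
every point is isolated, so it arises from some ball, and only its first occurrence is kept. -/
theorem exists_isEnumeration (E : Type*) [MetricSpace E] [MeasurableSpace E] [BorelSpace E]
    [SecondCountableTopology E] [Nonempty E] :
    ∃ V X, IsEnumeration (fun φ : PointMeasure E => pointSet (φ : Measure E)) V X := by
  classical
  set U : ℕ → Set E := fun k => Metric.ball (TopologicalSpace.denseSeq E k.unpair.1)
    (1 / ((k.unpair.2 : ℝ) + 1)) with hU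
  have hUm : ∀ k, MeasurableSet (U k) := fun k => Metric.isOpen_ball.measurableSet
  have hUsmall : ∀ (x : E) (r : ℝ), 0 < r → ∃ k, x ∈ U k ∧ U k ⊆ Metric.ball x r := by
    intro x r hr
    obtain ⟨n, hn⟩ := exists_nat_one_div_lt (half_pos hr)
    obtain ⟨i, hi⟩ := (TopologicalSpace.denseRange_denseSeq E).exists_dist_lt x
      (show (0 : ℝ) < 1 / ((n : ℝ) + 1) by positivity)
    refine ⟨Nat.pair i n, by simpa [hU] using hi, fun y hy => ?_⟩
    simp only [hU, Nat.unpair_pair, Metric.mem_ball] at hy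
    have := dist_triangle_right y x (TopologicalSpace.denseSeq E i)
    rw [Metric.mem_ball]
    linarith
  set W : ℕ → Set (PointMeasure E) := fun k =>
    {φ | ∃ x, pointSet (φ : Measure E) ∩ U k = {x}} with hW
  have hWm : ∀ k, MeasurableSet (W k) := by
    intro k
    have heq : W k = {φ : PointMeasure E | (φ : Measure E) (U k) ≠ 0} ∩ ⋂ i, ⋂ j,
        {φ : PointMeasure E | Disjoint (U i) (U j) →
        (φ : Measure E) (U k ∩ U i) = 0 ∨ (φ : Measure E) (U k ∩ U j) = 0} := by
      ext φ
      simp only [hW, Set.mem_ofPred_eq, Set.mem_inter_iff, Set.mem_iInter]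
      constructor
      · rintro ⟨x, hx⟩
        have hxm : x ∈ pointSet (φ : Measure E) ∩ U k := hx ▸ rfl
        refine ⟨φ.2.measure_ne_zero_iff.2 ⟨x, hxm.2, hxm.1⟩, fun i j hij => ?_⟩
        by_contra! hcon
        obtain ⟨y, hy, hyp⟩ := φ.2.measure_ne_zero_iff.1 hcon.1
        obtain ⟨z, hz, hzp⟩ := φ.2.measure_ne_zero_iff.1 hcon.2
        have h1 : y ∈ ({x} : Set E) := by rw [← hx]; exact ⟨hyp, hy.1⟩
        have h2 : z ∈ ({x} : Set E) := by rw [← hx]; exact ⟨hzp, hz.1⟩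
        rw [Set.mem_singleton_iff] at h1 h2
        exact Set.disjoint_left.1 hij hy.2 (h1.trans h2.symm ▸ hz.2)
      · rintro ⟨h0, hdisj⟩
        obtain ⟨x, hx, hxp⟩ := φ.2.measure_ne_zero_iff.1 h0
        refine ⟨x, Set.Subset.antisymm ?_ (Set.singleton_subset_iff.2 ⟨hxp, hx⟩)⟩
        rintro y ⟨hyp, hy⟩
        by_contra hne
        have hpos : 0 < dist x y / 2 := half_pos (dist_pos.2 (Ne.symm hne))
        obtain ⟨i, hi, hi'⟩ := hUsmall x _ hpos
        obtain ⟨j, hj, hj'⟩ := hUsmall y _ hpos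
        have hij : Disjoint (U i) (U j) := Set.disjoint_of_subset hi' hj'
          (Metric.ball_disjoint_ball (by linarith))
        rcases hdisj i j hij with h | h
        · exact (φ.2.measure_ne_zero_iff (B := U k ∩ U i)).2 ⟨x, ⟨hx, hi⟩, hxp⟩ h
        · exact (φ.2.measure_ne_zero_iff (B := U k ∩ U j)).2 ⟨y, ⟨hy, hj⟩, hyp⟩ h
    rw [heq]
    refine MeasurableSet.inter ?_ (MeasurableSet.iInter fun i => MeasurableSet.iInter fun j => ?_)
    · exact (measurable_pointMeasure_apply (hUm k)) (measurableSet_singleton 0).compl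
    · by_cases hij : Disjoint (U i) (U j)
      · simp only [hij, true_imp_iff]
        exact ((measurable_pointMeasure_apply ((hUm k).inter (hUm i)))
          (measurableSet_singleton 0)).union ((measurable_pointMeasure_apply
            ((hUm k).inter (hUm j))) (measurableSet_singleton 0))
      · simp [hij]
  set X : ℕ → PointMeasure E → E := fun k φ =>
    if h : φ ∈ W k then h.choose else Classical.arbitrary E with hX
  have hXspec : ∀ k φ, φ ∈ W k → pointSet (φ : Measure E) ∩ U k = {X k φ} := by
    intro k φ h
    simp only [hX, dif_pos h]
    exact h.choose_spec
  have hXm : ∀ k, Measurable (X k) := by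
    intro k C hC
    have heq : X k ⁻¹' C = (W k ∩ {φ | (φ : Measure E) (U k ∩ C) ≠ 0}) ∪
        ((W k)ᶜ ∩ {_φ | Classical.arbitrary E ∈ C}) := by
      ext φ
      by_cases h : φ ∈ W k
      · have hs := hXspec k φ h
        simp only [Set.mem_preimage, Set.mem_union, Set.mem_inter_iff, h, true_and,
          Set.mem_compl_iff, not_true_eq_false, false_and, or_false, Set.mem_ofPred_eq]
        rw [φ.2.measure_ne_zero_iff]
        have hm : X k φ ∈ pointSet (φ : Measure E) ∩ U k := hs ▸ rfl
        constructor
        · exact fun hc => ⟨X k φ, ⟨hm.2, hc⟩, hm.1⟩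
        · rintro ⟨x, ⟨hx, hxC⟩, hxp⟩
          have : x ∈ ({X k φ} : Set E) := by rw [← hs]; exact ⟨hxp, hx⟩
          rwa [← Set.mem_singleton_iff.1 this]
      · simp [h, hX]
    rw [heq]
    refine ((hWm k).inter ?_).union ((hWm k).compl.inter (MeasurableSet.const _))
    exact (measurable_pointMeasure_apply ((hUm k).inter hC)) (measurableSet_singleton 0).compl
  refine ⟨fun k => W k ∩ ⋂ j, ⋂ (_ : j < k), (W j ∩ {φ | X j φ = X k φ})ᶜ, X, ⟨fun k => ?_, hXm,
    fun φ x => ⟨fun hx => ?_, ?_⟩, fun φ k l hk hl hkl => ?_⟩⟩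
  · exact (hWm k).inter (MeasurableSet.iInter fun j => MeasurableSet.iInter fun _ =>
      ((hWm j).inter (measurableSet_eq_fun (hXm j) (hXm k))).compl)
  · have hex : ∃ k, φ ∈ W k ∧ X k φ = x := by
      have hfin := (φ.2.finite_pointSet_inter_closedBall x 1).subset
        (Set.inter_subset_inter_right (pointSet (φ : Measure E)) Metric.ball_subset_closedBall)
      have hfin' : ((pointSet (φ : Measure E) ∩ Metric.ball x 1) \ {x}).Finite := hfin.sdiff
      have hnhds : (((pointSet (φ : Measure E) ∩ Metric.ball x 1) \ {x})ᶜ) ∈ nhds x :=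
        hfin'.isClosed.isOpen_compl.mem_nhds (by simp)
      obtain ⟨r, hr, hsub⟩ := Metric.mem_nhds_iff.1 (Filter.inter_mem hnhds
        (Metric.ball_mem_nhds x one_pos))
      obtain ⟨k, hk, hk'⟩ := hUsmall x r hr
      have hs : pointSet (φ : Measure E) ∩ U k = {x} := by
        refine Set.Subset.antisymm ?_ (Set.singleton_subset_iff.2 ⟨hx, hk⟩)
        rintro y ⟨hyp, hy⟩
        have := hsub (hk' hy)
        by_contra hne
        exact this.1 ⟨⟨hyp, this.2⟩, hne⟩
      have hWk : φ ∈ W k := ⟨x, hs⟩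
      exact ⟨k, hWk, (Set.singleton_eq_singleton_iff.1 ((hXspec k φ hWk).symm.trans hs))⟩
    refine ⟨Nat.find hex, ⟨(Nat.find_spec hex).1, ?_⟩, (Nat.find_spec hex).2⟩
    simp only [Set.mem_iInter]
    intro j hj hcon
    exact Nat.find_min hex hj ⟨hcon.1, hcon.2.trans (Nat.find_spec hex).2⟩
  · rintro ⟨k, hk, rfl⟩
    have : X k φ ∈ pointSet (φ : Measure E) ∩ U k := (hXspec k φ hk.1) ▸ rfl
    exact this.1
  · simp only [Set.mem_inter_iff, Set.mem_iInter] at hk hl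
    rcases lt_trichotomy k l with h | h | h
    · exact absurd ⟨hk.1, hkl⟩ (hl.2 k h)
    · exact h
    · exact absurd ⟨hl.1, hkl.symm⟩ (hk.2 l h)

end PointMeasures

/-! ### Measurability of the procedure -/

section Measurability

variable {α E : Type*} [MeasurableSpace α] [MetricSpace E] [MeasurableSpace E] [BorelSpace E]
  [SecondCountableTopology E] {S : α → Set E} {D : α → E → ℕ} {V : ℕ → Set α} {X : ℕ → α → E}

theorem IsEnumeration.measurable_mem (h : IsEnumeration S V X) (k : ℕ) :
    Measurable fun a => X k a ∈ S a := by
  simp_rw [h.mem_iff]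
  exact Measurable.exists fun j => (measurableSet_setOfPred.1 (h.measurableSet j)).and
    (measurableSet_setOfPred.1 (measurableSet_eq_fun (h.measurable j) (h.measurable k)))

/-- Quantifiers over the points of `S a` become countable, which gives measurability of the
closest-point relation along an enumeration. -/
theorem IsEnumeration.measurable_isClosestCompatible (h : IsEnumeration S V X)
    {s : α → Stage E} (hadj : ∀ k l, Measurable fun a => (s a).graph.Adj (X k a) (X l a))
    (hstubs : ∀ k, Measurable fun a => (s a).stubs (X k a)) (k l : ℕ) :
    Measurable fun a => IsClosestCompatible (s a).graph ((s a).active (S a)) (X k a) (X l a) := by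
  have hne : ∀ i j, Measurable fun a => X i a ≠ X j a := fun i j =>
    (measurableSet_setOfPred.1 (measurableSet_eq_fun (h.measurable i) (h.measurable j))).not
  have hpos : ∀ i, Measurable fun a => 1 ≤ (s a).stubs (X i a) := fun i =>
    measurableSet_setOfPred.1 (measurableSet_le measurable_const (hstubs i))
  have hiff : ∀ a, IsClosestCompatible (s a).graph ((s a).active (S a)) (X k a) (X l a) ↔
      (X l a ∈ S a ∧ 1 ≤ (s a).stubs (X l a)) ∧ X l a ≠ X k a ∧
        ¬ (s a).graph.Adj (X k a) (X l a) ∧ ∀ j, a ∈ V j → 1 ≤ (s a).stubs (X j a) →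
          X j a ≠ X k a → X j a ≠ X l a → ¬ (s a).graph.Adj (X k a) (X j a) →
            dist (X k a) (X l a) < dist (X k a) (X j a) := by
    intro a
    refine and_congr Iff.rfl (and_congr Iff.rfl (and_congr Iff.rfl ⟨fun hz j hj h1 => ?_, ?_⟩))
    · exact hz _ ⟨(h.mem_iff a _).2 ⟨j, hj, rfl⟩, h1⟩
    · rintro hz z ⟨hzS, hz1⟩
      obtain ⟨j, hj, rfl⟩ := (h.mem_iff a z).1 hzS
      exact hz j hj hz1
  simp_rw [hiff]
  refine ((h.measurable_mem l).and (hpos l)).and ((hne l k).and ((hadj k l).not.and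
    (Measurable.forall fun j => ?_)))
  refine (measurableSet_setOfPred.1 (h.measurableSet j)).imp ((hpos j).imp ((hne j k).imp
    ((hne j l).imp ((hadj k j).not.imp (measurableSet_setOfPred.1 (measurableSet_lt ?_ ?_))))))
  · exact (h.measurable k).dist (h.measurable l)
  · exact (h.measurable k).dist (h.measurable j)

theorem IsEnumeration.measurable_stageAfter (h : IsEnumeration S V X)
    (hD : ∀ k, Measurable fun a => D a (X k a)) (n : ℕ) :
    (∀ k l, Measurable fun a => (stageAfter (S a) (D a) n).graph.Adj (X k a) (X l a)) ∧
      ∀ k, Measurable fun a => (stageAfter (S a) (D a) n).stubs (X k a) := by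
  classical
  induction n with
  | zero => exact ⟨fun k l => by simp [stageAfter], hD⟩
  | succ n ih =>
    have hmut : ∀ k l, Measurable fun a => (mutuallyClosest (stageAfter (S a) (D a) n).graph
        ((stageAfter (S a) (D a) n).active (S a))).Adj (X k a) (X l a) := fun k l =>
      (h.measurable_isClosestCompatible ih.1 ih.2 k l).and
        (h.measurable_isClosestCompatible ih.1 ih.2 l k)
    constructor
    · intro k l
      simp_rw [stageAfter_succ_adj]
      exact (ih.1 k l).or (hmut k l)
    · intro k
      have heq : (fun a => (stageAfter (S a) (D a) (n + 1)).stubs (X k a)) = fun a =>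
          if ∃ l, a ∈ V l ∧ (mutuallyClosest (stageAfter (S a) (D a) n).graph
            ((stageAfter (S a) (D a) n).active (S a))).Adj (X k a) (X l a)
          then (stageAfter (S a) (D a) n).stubs (X k a) - 1
          else (stageAfter (S a) (D a) n).stubs (X k a) := by
        ext a
        rw [stageAfter_succ]
        refine if_congr ⟨?_, fun ⟨l, _, hl⟩ => ⟨_, hl⟩⟩ rfl rfl
        rintro ⟨y, hy⟩
        obtain ⟨l, hl, rfl⟩ := (h.mem_iff a y).1 hy.1.1.1
        exact ⟨l, hl, hy⟩
      rw [heq]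
      refine Measurable.ite (measurableSet_setOfPred.2 (Measurable.exists fun l =>
        (measurableSet_setOfPred.1 (h.measurableSet l)).and (hmut k l))) ?_ (ih.2 k)
      exact (measurable_from_top (f := fun m : ℕ => m - 1)).comp (ih.2 k)

theorem IsEnumeration.measurable_limitGraph_adj (h : IsEnumeration S V X)
    (hD : ∀ k, Measurable fun a => D a (X k a)) (k l : ℕ) :
    Measurable fun a => (limitGraph (S a) (D a)).Adj (X k a) (X l a) := by
  simp_rw [limitGraph_adj]
  exact Measurable.exists fun n => (h.measurable_stageAfter hD n).1 k l

theorem IsEnumeration.measurableSet_unexhausted (h : IsEnumeration S V X)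
    (hD : ∀ k, Measurable fun a => D a (X k a)) {B : Set E} (hB : MeasurableSet B) :
    MeasurableSet {a | (unexhausted (S a) (D a)).Nonempty ∧ unexhausted (S a) (D a) ⊆ B} := by
  have hun : ∀ k, Measurable fun a => ∀ n, (stageAfter (S a) (D a) n).stubs (X k a) ≠ 0 :=
    fun k => Measurable.forall fun n => (measurableSet_setOfPred.1
      (((h.measurable_stageAfter hD n).2 k) (measurableSet_singleton 0))).not
  have hV : ∀ k, Measurable fun a => a ∈ V k := fun k =>
    measurableSet_setOfPred.1 (h.measurableSet k)
  have hiff : ∀ a, ((unexhausted (S a) (D a)).Nonempty ∧ unexhausted (S a) (D a) ⊆ B) ↔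
      (∃ k, a ∈ V k ∧ ∀ n, (stageAfter (S a) (D a) n).stubs (X k a) ≠ 0) ∧
      ∀ k, a ∈ V k → (∀ n, (stageAfter (S a) (D a) n).stubs (X k a) ≠ 0) → X k a ∈ B := by
    intro a
    constructor
    · rintro ⟨⟨x, hx⟩, hsub⟩
      obtain ⟨k, hk, rfl⟩ := (h.mem_iff a x).1 hx.1
      exact ⟨⟨k, hk, hx.2⟩, fun j hj hj' => hsub ⟨(h.mem_iff a _).2 ⟨j, hj, rfl⟩, hj'⟩⟩
    · rintro ⟨⟨k, hk, hk'⟩, hall⟩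
      refine ⟨⟨_, (h.mem_iff a _).2 ⟨k, hk, rfl⟩, hk'⟩, fun x hx => ?_⟩
      obtain ⟨j, hj, rfl⟩ := (h.mem_iff a x).1 hx.1
      exact hall j hj hx.2
  simp_rw [hiff]
  refine measurableSet_setOfPred.2 (Measurable.and
    (Measurable.exists fun k => (hV k).and (hun k)) (Measurable.forall fun k =>
      (hV k).imp ((hun k).imp (measurableSet_setOfPred.1 (h.measurable k hB)))))

end Measurability

section EdgeMeasure

variable {E : Type*} [MeasurableSpace E]

theorem edgeMeasure_apply (G : SimpleGraph E) {B : Set (E × E)} (hB : MeasurableSet B) :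
    edgeMeasure G B = (({p : E × E | G.Adj p.1 p.2} ∩ B).encard : ℝ≥0∞) := by
  rw [edgeMeasure, Measure.sum_apply _ hB, ← ENNReal.tsum_set_one]
  simp_rw [Measure.dirac_apply' _ hB]
  rw [tsum_subtype ({p : E × E | G.Adj p.1 p.2} ∩ B) fun _ => (1 : ℝ≥0∞)]
  refine (tsum_subtype {p : E × E | G.Adj p.1 p.2} (B.indicator 1)).trans (tsum_congr fun p => ?_)
  rw [Set.indicator_indicator]
  rfl

theorem edgeMeasure_singleton [MeasurableSingletonClass E] (G : SimpleGraph E) (x y : E)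
    [Decidable (G.Adj x y)] :
    edgeMeasure G {(x, y)} = if G.Adj x y then 1 else 0 := by
  rw [edgeMeasure_apply G (measurableSet_singleton _)]
  split_ifs with h
  · have hset : {p : E × E | G.Adj p.1 p.2} ∩ {(x, y)} = {(x, y)} :=
      Set.inter_eq_right.2 (Set.singleton_subset_iff.2 h)
    rw [hset, Set.encard_singleton]
    simp
  · have hset : {p : E × E | G.Adj p.1 p.2} ∩ {(x, y)} = ∅ :=
      Set.inter_singleton_eq_empty.2 h
    rw [hset, Set.encard_empty]
    simp

theorem mem_pointSet_edgeMeasure [MeasurableSingletonClass E] (G : SimpleGraph E) (x y : E) :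
    (x, y) ∈ pointSet (edgeMeasure G) ↔ G.Adj x y := by
  classical
  rw [pointSet, Set.mem_ofPred_eq, edgeMeasure_singleton]
  split_ifs with h <;> simp [h]

theorem edgeGraph_edgeMeasure [MeasurableSingletonClass E] (G : SimpleGraph E) :
    edgeGraph (edgeMeasure G) = G := by
  ext x y
  rw [edgeGraph, SimpleGraph.fromRel_adj, mem_pointSet_edgeMeasure, mem_pointSet_edgeMeasure,
    G.adj_comm y x, or_self, and_iff_right_iff_imp]
  exact SimpleGraph.Adj.ne

/-- The counting measure of the edges of a random graph is measurable if the graph is measurable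
along an enumeration of its vertices. -/
theorem IsEnumeration.measurable_edgeMeasure {α : Type*} [MeasurableSpace α] {S : α → Set E}
    {V : ℕ → Set α} {X : ℕ → α → E} (h : IsEnumeration S V X) {G : α → SimpleGraph E}
    (hG : ∀ a x y, (G a).Adj x y → x ∈ S a ∧ y ∈ S a)
    (hadj : ∀ k l, Measurable fun a => (G a).Adj (X k a) (X l a)) :
    Measurable fun a => edgeMeasure (G a) := by
  classical
  refine Measure.measurable_of_measurable_coe _ fun B hB => ?_
  have hset : ∀ q : ℕ × ℕ, MeasurableSet {a | a ∈ V q.1 ∧ a ∈ V q.2 ∧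
      (G a).Adj (X q.1 a) (X q.2 a) ∧ (X q.1 a, X q.2 a) ∈ B} := fun q =>
    (h.measurableSet q.1).inter ((h.measurableSet q.2).inter
      ((measurableSet_setOfPred.2 (hadj q.1 q.2)).inter
        (((h.measurable q.1).prodMk (h.measurable q.2)) hB)))
  have heq : (fun a => edgeMeasure (G a) B) = fun a => ∑' q : ℕ × ℕ,
      {a | a ∈ V q.1 ∧ a ∈ V q.2 ∧ (G a).Adj (X q.1 a) (X q.2 a) ∧
        (X q.1 a, X q.2 a) ∈ B}.indicator (fun _ => (1 : ℝ≥0∞)) a := by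
    ext a
    set Q : Set (ℕ × ℕ) := {q | a ∈ V q.1 ∧ a ∈ V q.2 ∧ (G a).Adj (X q.1 a) (X q.2 a) ∧
        (X q.1 a, X q.2 a) ∈ B} with hQ
    have himage : {p : E × E | (G a).Adj p.1 p.2} ∩ B =
        (fun q : ℕ × ℕ => (X q.1 a, X q.2 a)) '' Q := by
      ext ⟨x, y⟩
      constructor
      · rintro ⟨hxy, hB⟩
        obtain ⟨hx, hy⟩ := hG a x y hxy
        obtain ⟨k, hk, rfl⟩ := (h.mem_iff a x).1 hx
        obtain ⟨l, hl, rfl⟩ := (h.mem_iff a y).1 hy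
        exact ⟨(k, l), ⟨hk, hl, hxy, hB⟩, rfl⟩
      · rintro ⟨q, ⟨-, -, hq, hqB⟩, hqe⟩
        rw [← hqe]
        exact ⟨hq, hqB⟩
    have hinj : Set.InjOn (fun q : ℕ × ℕ => (X q.1 a, X q.2 a)) Q := by
      intro q hq r hr hqr
      rw [Prod.mk.injEq] at hqr
      exact Prod.ext (h.inj a _ _ hq.1 hr.1 hqr.1) (h.inj a _ _ hq.2.1 hr.2.1 hqr.2)
    rw [edgeMeasure_apply _ hB, himage, hinj.encard_image, ← ENNReal.tsum_set_one,
      tsum_subtype Q fun _ => (1 : ℝ≥0∞)]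
    rfl
  rw [heq]
  exact Measurable.tsum fun q => measurable_const.indicator (hset q)

variable [MetricSpace E]

theorem isPointMeasure_edgeMeasure {S : Set E}
    (hS : ∀ B, Bornology.IsBounded B → (S ∩ B).Finite) {G : SimpleGraph E}
    (hG : ∀ x y, G.Adj x y → x ∈ S ∧ y ∈ S) : IsPointMeasure (edgeMeasure G) := by
  intro B hB hbdd
  have hfin : ({p : E × E | G.Adj p.1 p.2} ∩ B).Finite := by
    refine ((hS _ hbdd.image_fst).prod (hS _ hbdd.image_snd)).subset ?_
    rintro ⟨x, y⟩ ⟨hadj, hp⟩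
    obtain ⟨hx, hy⟩ := hG x y hadj
    exact ⟨⟨hx, _, hp, rfl⟩, ⟨hy, _, hp, rfl⟩⟩
  refine ⟨hfin.toFinset.card, ?_⟩
  rw [edgeMeasure_apply G hB, hfin.encard_eq_coe_toFinset_card]
  rfl

variable [BorelSpace E] [SecondCountableTopology E]

/-- A point measure without multiple points is the counting measure of its graph of edges, if it is
symmetric and has no loops. -/
theorem IsPointMeasure.eq_edgeMeasure {φ : Measure (E × E)} (hφ : IsPointMeasure φ)
    (hsymm : ∀ x y, φ {(x, y)} = φ {(y, x)}) (hloop : ∀ x, φ {(x, x)} = 0)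
    (hmult : ∀ x y, φ {(x, y)} ≤ 1) : φ = edgeMeasure (edgeGraph φ) := by
  have hadj : ∀ p : E × E, (edgeGraph φ).Adj p.1 p.2 ↔ p ∈ pointSet φ := by
    rintro ⟨x, y⟩
    rw [edgeGraph, SimpleGraph.fromRel_adj]
    simp only [pointSet, Set.mem_ofPred_eq]
    rw [hsymm y x, or_self, and_iff_right_iff_imp]
    rintro h rfl
    exact h.ne' (hloop x)
  ext B hB
  have hcount := hφ.countable_pointSet
  have hnull : φ (B \ pointSet φ) = 0 := by
    by_contra h
    obtain ⟨p, hp, hp'⟩ := hφ.exists_mem_pointSet h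
    exact hp.2 hp'
  have hone : ∀ p ∈ pointSet φ, φ {p} = 1 := by
    rintro ⟨x, y⟩ hp
    refine le_antisymm (hmult x y) ?_
    obtain ⟨k, hk⟩ := hφ.exists_apply_singleton (x, y)
    have hpos : 0 < φ {(x, y)} := hp
    rw [hk] at hpos ⊢
    have : 0 < k := by exact_mod_cast hpos
    exact_mod_cast this
  rw [edgeMeasure_apply _ hB, ← measure_inter_add_sdiff B hcount.measurableSet, hnull, add_zero,
    ← Set.biUnion_of_singleton (B ∩ pointSet φ),
    measure_biUnion (hcount.mono Set.inter_subset_right)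
      (fun p _ q _ h => Set.disjoint_singleton.2 h) fun p _ => measurableSet_singleton p]
  have hset : {p : E × E | (edgeGraph φ).Adj p.1 p.2} ∩ B = B ∩ pointSet φ := by
    ext p
    rw [Set.inter_comm]
    exact and_congr_right fun _ => hadj p
  rw [hset, ← ENNReal.tsum_set_one]
  exact tsum_congr fun p => hone _ p.2.2

/-- The counting measure of the edges of the limiting graph, as a function of the point measures
of points and of marks. -/
noncomputable def limitEdges (q : PointMeasure E × PointMeasure E) : Measure (E × E) :=
  edgeMeasure (limitGraph (pointSet (q.1 : Measure E)) (stubCount (q.2 : Measure E)))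

theorem measurable_stubCount {α : Type*} [MeasurableSpace α] {N : α → PointMeasure E}
    (hN : Measurable N) {X : α → E} (hX : Measurable X) :
    Measurable fun a => stubCount (N a : Measure E) (X a) :=
  Nat.measurable_floor.comp (measurable_apply_singleton (measurable_subtype_coe.comp hN)
    (fun a => (N a).2) hX).ennreal_toReal

theorem measurable_limitEdges [Nonempty E] : Measurable (limitEdges (E := E)) := by
  obtain ⟨V, X, h⟩ := exists_isEnumeration E
  have h' := h.comp (measurable_fst (α := PointMeasure E) (β := PointMeasure E))
  exact h'.measurable_edgeMeasure (fun _ _ _ => limitGraph_adj_mem)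
    (h'.measurable_limitGraph_adj fun k => measurable_stubCount measurable_snd (h'.measurable k))

theorem measurableSet_unexhausted_subset [Nonempty E] {B : Set E} (hB : MeasurableSet B) :
    MeasurableSet {q : PointMeasure E × PointMeasure E |
      (unexhausted (pointSet (q.1 : Measure E)) (stubCount (q.2 : Measure E))).Nonempty ∧
        unexhausted (pointSet (q.1 : Measure E)) (stubCount (q.2 : Measure E)) ⊆ B} := by
  obtain ⟨V, X, h⟩ := exists_isEnumeration E
  have h' := h.comp (measurable_fst (α := PointMeasure E) (β := PointMeasure E))
  exact h'.measurableSet_unexhausted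
    (fun k => measurable_stubCount measurable_snd (h'.measurable k)) hB

end EdgeMeasure

/-! ### Translation invariance of the Poisson process -/

/-- Laws can be compared after a map that generates the σ-algebra. -/
theorem map_eq_of_map_comp_eq {Ω β γ : Type*} [MeasurableSpace Ω] [mβ : MeasurableSpace β]
    [MeasurableSpace γ] {Pr : Measure Ω} {i : β → γ} (hi : Measurable i)
    (hle : mβ ≤ MeasurableSpace.comap i inferInstance) {f g : Ω → β} (hf : Measurable f)
    (hg : Measurable g) (h : Pr.map (fun ω => i (f ω)) = Pr.map fun ω => i (g ω)) :
    Pr.map f = Pr.map g := by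
  ext A hA
  obtain ⟨A', hA', rfl⟩ := hle A hA
  have h' := congrArg (fun ν => ν A') h
  simp only [Measure.map_apply (hi.fun_comp hf) hA', Measure.map_apply (hi.fun_comp hg) hA'] at h'
  rw [Measure.map_apply hf hA, Measure.map_apply hg hA]
  exact h'

theorem map_comp_eq_of_map_eq {Ω β γ : Type*} [MeasurableSpace Ω] [MeasurableSpace β]
    [MeasurableSpace γ] {Pr : Measure Ω} {F : β → γ} (hF : Measurable F) {f g : Ω → β}
    (hf : Measurable f) (hg : Measurable g) (h : Pr.map f = Pr.map g) :
    Pr.map (fun ω => F (f ω)) = Pr.map fun ω => F (g ω) := by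
  have h' := congrArg (Measure.map F) h
  rwa [Measure.map_map hF hf, Measure.map_map hF hg] at h'

section PoissonLaw

variable {d : ℕ} {Ω : Type*} [MeasurableSpace Ω] {Pr : Measure Ω}
  {P Q : Ω → Measure (EuclideanSpace ℝ (Fin d))}

theorem IsPoissonProcess.map_apply_eq (hP : IsPoissonProcess Pr P) (hQ : IsPoissonProcess Pr Q)
    {B : Set (EuclideanSpace ℝ (Fin d))} (hB : MeasurableSet B) (hfin : volume B ≠ ∞) :
    Pr.map (fun ω => P ω B) = Pr.map (fun ω => Q ω B) := by
  rw [hP.count_law B hB hfin, hQ.count_law B hB hfin]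

theorem IsPoissonProcess.map_disjoint_eq [IsProbabilityMeasure Pr] (hP : IsPoissonProcess Pr P)
    {ι : Type*} [Fintype ι] {B : ι → Set (EuclideanSpace ℝ (Fin d))}
    (hB : ∀ i, MeasurableSet (B i)) (hdisj : Pairwise (Function.onFun Disjoint B)) :
    Pr.map (fun ω i => P ω (B i)) = Measure.pi fun i => Pr.map fun ω => P ω (B i) := by
  refine (iIndepFun_iff_map_fun_eq_pi_map
    fun i => (hP.measurable_apply (hB i)).aemeasurable).1 ?_
  have h := hP.count_indep (Fintype.card ι) (fun i => B ((Fintype.equivFin ι).symm i))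
    (fun i => hB _) fun i j hij => hdisj ((Fintype.equivFin ι).symm.injective.ne hij)
  have h' := h.precomp (g := Fintype.equivFin ι) (Fintype.equivFin ι).injective
  simpa only [Equiv.symm_apply_apply] using h'

/-- The law of the numbers of points in finitely many sets of finite volume, which need not be
disjoint: each set is the disjoint union of atoms of the finite algebra that the sets generate. -/
theorem IsPoissonProcess.map_finite_eq [IsProbabilityMeasure Pr] (hP : IsPoissonProcess Pr P)
    (hQ : IsPoissonProcess Pr Q) {ι : Type*} [Finite ι]
    {B : ι → Set (EuclideanSpace ℝ (Fin d))} (hB : ∀ i, MeasurableSet (B i))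
    (hfin : ∀ i, volume (B i) ≠ ∞) :
    Pr.map (fun ω i => P ω (B i)) = Pr.map (fun ω i => Q ω (B i)) := by
  classical
  have := Fintype.ofFinite ι
  -- the empty index set is left out, since its atom has infinite volume
  let J := {s : Finset ι // s.Nonempty}
  let atom : J → Set (EuclideanSpace ℝ (Fin d)) := fun s => {x | ∀ i, x ∈ B i ↔ i ∈ s.1}
  have hatom : ∀ s, MeasurableSet (atom s) := by
    intro s
    refine measurableSet_setOfPred.2 (Measurable.forall fun i => ?_)
    exact (measurableSet_setOfPred.1 (hB i)).iff measurable_const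
  have hdisj : Pairwise (Function.onFun Disjoint atom) := by
    intro s t hst
    refine Set.disjoint_left.2 fun x hx hx' => hst (Subtype.ext (Finset.ext fun i => ?_))
    rw [← hx i, ← hx' i]
  have hatomfin : ∀ s, volume (atom s) ≠ ∞ := by
    rintro ⟨s, i, hi⟩
    exact ((measure_mono fun x hx => (hx i).2 hi).trans_lt (hfin i).lt_top).ne
  have hsplit : ∀ (ν : Measure (EuclideanSpace ℝ (Fin d))) (i : ι),
      ν (B i) = ∑ s : J, if i ∈ s.1 then ν (atom s) else 0 := by
    intro ν i
    have hunion : B i = ⋃ s ∈ Finset.univ.filter fun s : J => i ∈ s.1, atom s := by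
      ext x
      simp only [Finset.mem_filter, Finset.mem_univ, true_and, Set.mem_iUnion, exists_prop]
      constructor
      · intro hx
        refine ⟨⟨Finset.univ.filter fun j => x ∈ B j, i, by simpa using hx⟩, by simpa using hx,
          fun j => by simp⟩
      · rintro ⟨s, hs, hxs⟩
        exact (hxs i).2 hs
    rw [hunion, measure_biUnion_finset (fun s _ t _ hst => hdisj hst) fun s _ => hatom s,
      Finset.sum_filter]
  have hΦ : Measurable fun (y : J → ℝ≥0∞) (i : ι) => ∑ s : J, if i ∈ s.1 then y s else 0 := by
    refine measurable_pi_lambda _ fun i => Finset.measurable_sum _ fun s _ => ?_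
    split_ifs
    · exact measurable_pi_apply s
    · exact measurable_const
  have hmap : ∀ {R : Ω → Measure (EuclideanSpace ℝ (Fin d))}, IsPoissonProcess Pr R →
      Pr.map (fun ω i => R ω (B i)) = (Measure.pi fun s => Pr.map fun ω => R ω (atom s)).map
        fun (y : J → ℝ≥0∞) (i : ι) => ∑ s : J, if i ∈ s.1 then y s else 0 := by
    intro R hR
    rw [← hR.map_disjoint_eq hatom hdisj, Measure.map_map hΦ
      (measurable_pi_lambda _ fun s => hR.measurable_apply (hatom s))]
    congr 1
    ext ω i
    exact hsplit (R ω) i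
  rw [hmap hP, hmap hQ]
  congr 2
  ext1 s
  exact hP.map_apply_eq hQ (hatom s) (hatomfin s)

/-- The σ-algebra of `Measure E` is generated by the evaluations at the measurable sets of finite
volume. -/
theorem measurableSpace_le_comap_finite_volume : (Measure.instMeasurableSpace :
    MeasurableSpace (Measure (EuclideanSpace ℝ (Fin d)))) ≤ MeasurableSpace.comap
      (fun φ (t : {B : Set (EuclideanSpace ℝ (Fin d)) // MeasurableSet B ∧ volume B ≠ ∞}) =>
        φ t.1) inferInstance := by
  refine iSup₂_le fun s hs => Measurable.comap_le ?_
  have heq : (fun φ : Measure (EuclideanSpace ℝ (Fin d)) => φ s) =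
      fun φ => ⨆ n : ℕ, φ (s ∩ Metric.ball 0 n) := by
    ext φ
    rw [← Monotone.measure_iUnion, ← Set.inter_iUnion, Metric.iUnion_ball_nat, Set.inter_univ]
    exact fun m n hmn => Set.inter_subset_inter_right _
      (Metric.ball_subset_ball (by exact_mod_cast hmn))
  rw [heq]
  refine Measurable.iSup fun n => ?_
  have hn : MeasurableSet (s ∩ Metric.ball 0 n) ∧ volume (s ∩ Metric.ball 0 n) ≠ ∞ :=
    ⟨hs.inter Metric.isOpen_ball.measurableSet,
      ((measure_mono Set.inter_subset_right).trans_lt measure_ball_lt_top).ne⟩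
  exact (measurable_pi_apply (X := fun _ => ℝ≥0∞) (⟨s ∩ Metric.ball 0 n, hn⟩ :
    {B : Set (EuclideanSpace ℝ (Fin d)) // MeasurableSet B ∧ volume B ≠ ∞})).comp
      (comap_measurable _)

/-- Any two Poisson processes of intensity `1` have the same law. -/
theorem IsPoissonProcess.map_eq [IsProbabilityMeasure Pr] (hP : IsPoissonProcess Pr P)
    (hQ : IsPoissonProcess Pr Q) : Pr.map P = Pr.map Q := by
  have hmeas : ∀ {R : Ω → Measure (EuclideanSpace ℝ (Fin d))}, IsPoissonProcess Pr R →
      Measurable fun ω (t : {B : Set (EuclideanSpace ℝ (Fin d)) //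
        MeasurableSet B ∧ volume B ≠ ∞}) => R ω t.1 :=
    fun hR => measurable_pi_lambda _ fun t => hR.measurable_apply t.2.1
  refine map_eq_of_map_comp_eq
    (measurable_pi_lambda _ fun t => Measure.measurable_coe t.2.1)
    measurableSpace_le_comap_finite_volume hP.isPointProcess.measurable
    hQ.isPointProcess.measurable ?_
  refine (map_eq_iff_forall_finset_map_restrict_eq (hmeas hP).aemeasurable
    (hmeas hQ).aemeasurable).2 fun I => ?_
  exact hP.map_finite_eq hQ (B := fun t : I => t.1.1) (fun t => t.1.2.1) fun t => t.1.2.2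

end PoissonLaw

section Translation

variable {E : Type*} [NormedAddCommGroup E] [MeasurableSpace E] [BorelSpace E]

theorem IsPointMeasure.map_add_right {φ : Measure E} (hφ : IsPointMeasure φ) (v : E) :
    IsPointMeasure (φ.map (· + v)) := by
  intro B hB hbdd
  rw [Measure.map_apply (measurable_add_const v) hB]
  exact hφ _ (measurable_add_const v hB)
    ((isometry_add_right v).antilipschitz.isBounded_preimage hbdd)

/-- Translation of point measures. -/
noncomputable def PointMeasure.translate (v : E) (φ : PointMeasure E) : PointMeasure E :=
  ⟨φ.1.map (· + v), φ.2.map_add_right v⟩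

theorem PointMeasure.measurable_translate (v : E) : Measurable (PointMeasure.translate v) :=
  ((Measure.measurable_map _ (measurable_add_const v)).comp measurable_subtype_coe).subtype_mk

theorem map_add_right_singleton (φ : Measure E) (v x : E) :
    φ.map (· + v) {x + v} = φ {x} := by
  rw [Measure.map_apply (measurable_add_const v) (measurableSet_singleton _)]
  congr 1
  ext y
  simp

theorem pointSet_map_add_right (φ : Measure E) (v : E) :
    pointSet (φ.map (· + v)) = (· + v) '' pointSet φ := by
  ext x
  obtain ⟨x, rfl⟩ : ∃ y, y + v = x := ⟨x - v, by simp⟩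
  simp [pointSet, map_add_right_singleton]

theorem stubCount_map_add_right (φ : Measure E) (v x : E) :
    stubCount (φ.map (· + v)) (x + v) = stubCount φ x := by
  rw [stubCount, stubCount, map_add_right_singleton]

end Translation

theorem IsPoissonProcess.map_add_right {d : ℕ} {Ω : Type*} [MeasurableSpace Ω] {Pr : Measure Ω}
    {P : Ω → Measure (EuclideanSpace ℝ (Fin d))} (hP : IsPoissonProcess Pr P)
    (v : EuclideanSpace ℝ (Fin d)) : IsPoissonProcess Pr fun ω => (P ω).map (· + v) where
  isPointProcess :=
    ⟨(Measure.measurable_map _ (measurable_add_const v)).comp hP.isPointProcess.measurable,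
      fun ω => (hP.isPointProcess.isPointMeasure ω).map_add_right v⟩
  count_law B hB hfin := by
    have hvol : volume ((· + v) ⁻¹' B) = volume B := measure_preimage_add_right _ _ _
    simp_rw [Measure.map_apply (measurable_add_const v) hB]
    rw [hP.count_law _ (measurable_add_const v hB) (hvol ▸ hfin), hvol]
  count_indep n B hB hdisj := by
    simp_rw [Measure.map_apply (measurable_add_const v) (hB _)]
    exact hP.count_indep n _ (fun i => measurable_add_const v (hB i))
      fun i j hij => (hdisj hij).preimage _

/-! ### The law of the marks -/

section Marks

/-- Restricting an i.i.d. family along an injection gives an i.i.d. family. -/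
theorem infinitePi_map_comp {α β : Type*} (μ : Measure ℕ) [IsProbabilityMeasure μ] {f : α → β}
    (hf : f.Injective) :
    (Measure.infinitePi fun _ : β => μ).map (fun k a => k (f a)) =
      Measure.infinitePi fun _ : α => μ := by
  refine Measure.eq_infinitePi _ fun s t ht => ?_
  -- `t'` extends `t` along `f`; it is only evaluated on the range of `f`
  set t' : β → Set ℕ := fun b => {n | ∀ a, f a = b → n ∈ t a} with ht'
  have htf : ∀ a, t' (f a) = t a := by
    intro a
    ext n
    exact ⟨fun h => h a rfl, fun h a' ha' => hf ha' ▸ h⟩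
  have hpre : (fun (k : β → ℕ) a => k (f a)) ⁻¹' (s : Set α).pi t =
      (s.map ⟨f, hf⟩ : Set β).pi t' := by
    ext k
    simp [Set.mem_pi, htf]
  have hm : Measurable fun (k : β → ℕ) a => k (f a) :=
    measurable_pi_lambda _ fun a => measurable_pi_apply _
  rw [Measure.map_apply hm (MeasurableSet.pi s.countable_toSet fun a _ => ht a), hpre,
    Measure.infinitePi_pi _ fun _ _ => MeasurableSet.of_discrete, Finset.prod_map]
  simp [htf]

variable {E : Type*} [MeasurableSpace E]

theorem markedMeasure_apply (A : Set E) (k : A → ℕ) {B : Set E} (hB : MeasurableSet B) :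
    markedMeasure A k B = ∑' x : A, (k x : ℝ≥0∞) * B.indicator 1 (x : E) := by
  simp [markedMeasure, Measure.sum_apply _ hB, Measure.dirac_apply' _ hB]

theorem measurable_markedMeasure {A : Set E} (hA : A.Countable) : Measurable (markedMeasure A) := by
  have := hA.to_subtype
  refine Measure.measurable_of_measurable_coe _ fun B hB => ?_
  simp_rw [markedMeasure_apply A _ hB]
  exact Measurable.tsum fun x =>
    ((measurable_from_top (f := fun n : ℕ => (n : ℝ≥0∞))).comp (measurable_pi_apply x)).mul_const _

/-- The measure with masses `k i` at those points `X i a` of an enumeration that are present. -/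
noncomputable def enumeratedMeasure {α : Type*} (V : ℕ → Set α) (X : ℕ → α → E)
    (q : α × (ℕ → ℕ)) : Measure E :=
  Measure.sum fun i => (V i).indicator (fun a => (q.2 i : ℝ≥0∞) • Measure.dirac (X i a)) q.1

theorem enumeratedMeasure_apply {α : Type*} (V : ℕ → Set α) (X : ℕ → α → E) (q : α × (ℕ → ℕ))
    {B : Set E} (hB : MeasurableSet B) :
    enumeratedMeasure V X q B =
      ∑' i, (V i).indicator (fun a => (q.2 i : ℝ≥0∞) * B.indicator 1 (X i a)) q.1 := by
  rw [enumeratedMeasure, Measure.sum_apply _ hB]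
  refine tsum_congr fun i => ?_
  by_cases h : q.1 ∈ V i <;> simp [h, Measure.dirac_apply' _ hB]

variable {α : Type*} [MeasurableSpace α] {S : α → Set E} {V : ℕ → Set α} {X : ℕ → α → E}

theorem IsEnumeration.measurable_enumeratedMeasure (h : IsEnumeration S V X) :
    Measurable (enumeratedMeasure V X) := by
  refine Measure.measurable_of_measurable_coe _ fun B hB => ?_
  simp_rw [enumeratedMeasure_apply V X _ hB]
  refine Measurable.tsum fun i => ?_
  have hind : Measurable fun q : α × (ℕ → ℕ) =>
      (q.2 i : ℝ≥0∞) * B.indicator 1 (X i q.1) :=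
    ((measurable_from_top (f := fun n : ℕ => (n : ℝ≥0∞))).comp
      ((measurable_pi_apply i).comp measurable_snd)).mul
        ((measurable_one.indicator hB).comp ((h.measurable i).comp measurable_fst))
  exact hind.indicator (measurable_fst (h.measurableSet i))

/-- The i.i.d. marks of the points of `S a` can be read off from a single i.i.d. sequence, by
giving the `i`-th mark to the `i`-th point of the enumeration. -/
theorem IsEnumeration.iidMarkLaw_eq (h : IsEnumeration S V X) (μ : Measure ℕ)
    [IsProbabilityMeasure μ] (a : α) :
    iidMarkLaw μ (S a) = (Measure.infinitePi fun _ : ℕ => μ).map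
      fun k => enumeratedMeasure V X (a, k) := by
  choose f hf hfX using fun x : S a => (h.mem_iff a x).1 x.2
  have hinj : f.Injective := fun x y hxy => Subtype.ext (by rw [← hfX x, ← hfX y, hxy])
  have hcount : (S a).Countable := Set.countable_coe_iff.1 hinj.countable
  rw [iidMarkLaw, ← infinitePi_map_comp μ hinj, Measure.map_map (measurable_markedMeasure hcount)
    (measurable_pi_lambda _ fun a => measurable_pi_apply _)]
  congr 1
  ext k B hB
  rw [Function.comp_apply, markedMeasure_apply _ _ hB, enumeratedMeasure_apply V X _ hB]
  rw [← hinj.tsum_eq (f := fun i => (V i).indicator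
    (fun a => (k i : ℝ≥0∞) * B.indicator 1 (X i a)) a)]
  · refine tsum_congr fun x => ?_
    rw [Set.indicator_of_mem (hf x), hfX]
  · intro i hi
    have hiV : a ∈ V i := by
      by_contra hcon
      exact hi (Set.indicator_of_notMem hcon _)
    refine ⟨⟨X i a, (h.mem_iff a _).2 ⟨i, hiV, rfl⟩⟩, h.inj a _ _ (hf _) hiV (hfX _)⟩

/-- The kernel of i.i.d. marks is measurable. -/
theorem IsEnumeration.measurable_iidMarkLaw_apply (h : IsEnumeration S V X) (μ : Measure ℕ)
    [IsProbabilityMeasure μ] {A : Set (α × Measure E)} (hA : MeasurableSet A) :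
    Measurable fun a => iidMarkLaw μ (S a) {m | (a, m) ∈ A} := by
  have heq : ∀ a, iidMarkLaw μ (S a) {m | (a, m) ∈ A} = Measure.infinitePi (fun _ : ℕ => μ)
      (Prod.mk a ⁻¹' ((fun q => (q.1, enumeratedMeasure V X q)) ⁻¹' A)) := by
    intro a
    rw [h.iidMarkLaw_eq μ a]
    exact Measure.map_apply (h.measurable_enumeratedMeasure.comp measurable_prodMk_left)
      (measurable_prodMk_left hA)
  simp_rw [heq]
  exact measurable_measure_prodMk_left
    ((measurable_fst.prodMk h.measurable_enumeratedMeasure) hA)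

theorem iidMarkLaw_image_add_right {E : Type*} [NormedAddCommGroup E] [MeasurableSpace E]
    [BorelSpace E] (μ : Measure ℕ) [IsProbabilityMeasure μ] {A : Set E} (hA : A.Countable) (v : E) :
    iidMarkLaw μ ((· + v) '' A) = (iidMarkLaw μ A).map fun m => m.map (· + v) := by
  set e : A ≃ (· + v) '' A := Equiv.Set.image _ A (add_left_injective v) with he
  rw [iidMarkLaw, iidMarkLaw, ← infinitePi_map_comp μ e.symm.injective,
    Measure.map_map (measurable_markedMeasure (hA.image _))
      (measurable_pi_lambda _ fun a => measurable_pi_apply _),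
    Measure.map_map (Measure.measurable_map _ (measurable_add_const v))
      (measurable_markedMeasure hA)]
  congr 1
  ext k B hB
  rw [Function.comp_apply, Function.comp_apply, Measure.map_apply (measurable_add_const v) hB,
    markedMeasure_apply _ _ hB, markedMeasure_apply _ _ (measurable_add_const v hB), ← e.tsum_eq]
  refine tsum_congr fun x => ?_
  rw [Equiv.symm_apply_apply]
  rfl

end Marks

section MarkedProcess

/-- A pair of point processes as a random element of the space of pairs of point measures. -/
def pointMeasurePair {E Ω : Type*} [MetricSpace E] [MeasurableSpace E] [MeasurableSpace Ω]
    {P ξ : Ω → Measure E} (hP : IsPointProcess P) (hξ : IsPointProcess ξ) (ω : Ω) :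
    PointMeasure E × PointMeasure E :=
  (⟨P ω, hP.isPointMeasure ω⟩, ⟨ξ ω, hξ.isPointMeasure ω⟩)

theorem measurable_pointMeasurePair {E Ω : Type*} [MetricSpace E] [MeasurableSpace E]
    [MeasurableSpace Ω] {P ξ : Ω → Measure E} (hP : IsPointProcess P) (hξ : IsPointProcess ξ) :
    Measurable (pointMeasurePair hP hξ) :=
  hP.measurable.subtype_mk.prodMk hξ.measurable.subtype_mk

theorem limitScheme_eq {E Ω : Type*} [MetricSpace E] [MeasurableSpace E] [MeasurableSpace Ω]
    {P ξ : Ω → Measure E} (hP : IsPointProcess P) (hξ : IsPointProcess ξ) :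
    limitScheme P ξ = fun ω => limitEdges (pointMeasurePair hP hξ ω) :=
  rfl

/-- Translation of a pair of point measures. -/
noncomputable def translatePair {E : Type*} [NormedAddCommGroup E] [MeasurableSpace E]
    [BorelSpace E] (v : E) (q : PointMeasure E × PointMeasure E) :
    PointMeasure E × PointMeasure E :=
  (q.1.translate v, q.2.translate v)

theorem measurable_translatePair {E : Type*} [NormedAddCommGroup E] [MeasurableSpace E]
    [BorelSpace E] (v : E) : Measurable (translatePair v) :=
  ((PointMeasure.measurable_translate v).comp measurable_fst).prodMk
    ((PointMeasure.measurable_translate v).comp measurable_snd)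

/-- The law of a process of points with i.i.d. marks is invariant under translations if the law of
the points is, as the conditional law of the marks is equivariant. -/
theorem IsIIDMarking.map_translatePair_eq {E Ω : Type*} [NormedAddCommGroup E]
    [MeasurableSpace E] [BorelSpace E] [SecondCountableTopology E] [MeasurableSpace Ω]
    {Pr : Measure Ω} {μ : Measure ℕ} [IsProbabilityMeasure μ] {P ξ : Ω → Measure E}
    (hP : IsPointProcess P) (hξ : IsIIDMarking Pr μ P ξ) (v : E)
    (hlaw : Pr.map (fun ω => (P ω).map (· + v)) = Pr.map P) :
    Pr.map (fun ω => translatePair v (pointMeasurePair hP hξ.isPointProcess ω)) =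
      Pr.map (pointMeasurePair hP hξ.isPointProcess) := by
  obtain ⟨V, X, hVX⟩ := exists_isEnumeration E
  have hτ : Measurable fun φ : Measure E => φ.map (· + v) :=
    Measure.measurable_map _ (measurable_add_const v)
  set P' : Ω → PointMeasure E := fun ω => ⟨P ω, hP.isPointMeasure ω⟩ with hP'
  have hPm := hP.measurable
  have hξm := hξ.isPointProcess.measurable
  have hP'm : Measurable P' := hPm.subtype_mk
  have hτP'm : Measurable fun ω => (P' ω).translate v :=
    (PointMeasure.measurable_translate v).comp hP'm
  have hlawP : Pr.map (fun ω => (P' ω).translate v) = Pr.map P' :=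
    map_eq_of_map_comp_eq measurable_subtype_coe le_rfl hτP'm hP'm hlaw
  let J : PointMeasure E × PointMeasure E → Measure E × Measure E := fun q => (q.1, q.2)
  have hJ : Measurable J := (measurable_subtype_coe.comp measurable_fst).prodMk
    (measurable_subtype_coe.comp measurable_snd)
  have hle : (inferInstance : MeasurableSpace (PointMeasure E × PointMeasure E)) ≤
      MeasurableSpace.comap J inferInstance := by
    refine sup_le ?_ ?_
    · rw [show (Subtype.instMeasurableSpace : MeasurableSpace (PointMeasure E)) =
        MeasurableSpace.comap Subtype.val inferInstance from rfl, MeasurableSpace.comap_comp]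
      exact (measurable_fst.comp (comap_measurable J)).comap_le
    · rw [show (Subtype.instMeasurableSpace : MeasurableSpace (PointMeasure E)) =
        MeasurableSpace.comap Subtype.val inferInstance from rfl, MeasurableSpace.comap_comp]
      exact (measurable_snd.comp (comap_measurable J)).comap_le
  have hpair := measurable_pointMeasurePair hP hξ.isPointProcess
  refine map_eq_of_map_comp_eq hJ hle ((measurable_translatePair v).comp hpair) hpair ?_
  ext A hA
  have hg : Measurable fun φ : PointMeasure E =>
      iidMarkLaw μ (pointSet (φ : Measure E)) {m | ((φ : Measure E), m) ∈ A} :=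
    hVX.measurable_iidMarkLaw_apply μ (A := (fun q => ((q.1 : Measure E), q.2)) ⁻¹' A)
      (((measurable_subtype_coe.comp measurable_fst).prodMk measurable_snd) hA)
  have h1 : Pr.map (fun ω => J (pointMeasurePair hP hξ.isPointProcess ω)) A =
      ∫⁻ ω, iidMarkLaw μ (pointSet (P' ω : Measure E)) {m | ((P' ω : Measure E), m) ∈ A} ∂Pr :=
    (Measure.map_apply (hPm.prodMk hξm) hA).trans (hξ.cond_law A hA)
  have h2 : Pr.map (fun ω => J (translatePair v (pointMeasurePair hP hξ.isPointProcess ω))) A =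
      ∫⁻ ω, iidMarkLaw μ (pointSet ((P' ω).translate v : Measure E))
        {m | (((P' ω).translate v : Measure E), m) ∈ A} ∂Pr := by
    refine (Measure.map_apply ((hτ.comp hPm).prodMk (hτ.comp hξm)) hA).trans ?_
    refine (hξ.cond_law ((fun q => (q.1.map (· + v), q.2.map (· + v))) ⁻¹' A)
      (((hτ.comp measurable_fst).prodMk (hτ.comp measurable_snd)) hA)).trans
        (lintegral_congr fun ω => ?_)
    have hset : pointSet ((P' ω).translate v : Measure E) = (· + v) '' pointSet (P ω) :=
      pointSet_map_add_right _ _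
    rw [hset, iidMarkLaw_image_add_right μ (hP.isPointMeasure ω).countable_pointSet v]
    exact (Measure.map_apply (μ := iidMarkLaw μ (pointSet (P ω))) hτ
      (measurable_prodMk_left (x := (P ω).map (· + v)) hA)).symm
  refine h2.trans (Eq.trans ?_ h1.symm)
  rw [← lintegral_map hg hτP'm, hlawP, lintegral_map hg hP'm]

end MarkedProcess

/-! ### Translation invariance of the limiting graph and exhaustion of the stubs -/

section Equivariance

variable {E : Type*} [MetricSpace E] {S : Set E} {D D' : E → ℕ}

theorem isClosestCompatible_map (e : E ≃ᵢ E) {G G' : SimpleGraph E} {A A' : Set E}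
    (hG : ∀ x y, G'.Adj (e x) (e y) ↔ G.Adj x y) (hA : ∀ x, e x ∈ A' ↔ x ∈ A) (x y : E) :
    IsClosestCompatible G' A' (e x) (e y) ↔ IsClosestCompatible G A x y := by
  rw [IsClosestCompatible, e.surjective.forall]
  simp only [IsClosestCompatible, hG, hA, e.injective.ne_iff, e.dist_eq]

/-- The procedure commutes with isometries. -/
theorem stageAfter_map (e : E ≃ᵢ E) (hD : ∀ x, D' (e x) = D x) (n : ℕ) :
    (∀ x y, (stageAfter (e '' S) D' n).graph.Adj (e x) (e y) ↔
        (stageAfter S D n).graph.Adj x y) ∧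
      ∀ x, (stageAfter (e '' S) D' n).stubs (e x) = (stageAfter S D n).stubs x := by
  classical
  induction n with
  | zero => exact ⟨fun x y => by simp [stageAfter], hD⟩
  | succ n ih =>
    have hact : ∀ x, e x ∈ (stageAfter (e '' S) D' n).active (e '' S) ↔
        x ∈ (stageAfter S D n).active S := fun x => by
      simp only [Stage.active, Set.mem_ofPred_eq, ih.2, e.injective.mem_set_image]
    have hmut : ∀ x y, (mutuallyClosest (stageAfter (e '' S) D' n).graph
        ((stageAfter (e '' S) D' n).active (e '' S))).Adj (e x) (e y) ↔
        (mutuallyClosest (stageAfter S D n).graph ((stageAfter S D n).active S)).Adj x y :=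
      fun x y => and_congr (isClosestCompatible_map e ih.1 hact x y)
        (isClosestCompatible_map e ih.1 hact y x)
    refine ⟨fun x y => ?_, fun x => ?_⟩
    · rw [stageAfter_succ_adj, stageAfter_succ_adj, ih.1, hmut]
    · rw [stageAfter_succ, stageAfter_succ]
      refine if_congr ?_ (by rw [ih.2]) (ih.2 x)
      rw [e.surjective.exists]
      exact exists_congr fun y => hmut x y

theorem limitGraph_map_adj (e : E ≃ᵢ E) (hD : ∀ x, D' (e x) = D x) (x y : E) :
    (limitGraph (e '' S) D').Adj (e x) (e y) ↔ (limitGraph S D).Adj x y := by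
  rw [limitGraph_adj, limitGraph_adj]
  exact exists_congr fun n => (stageAfter_map e hD n).1 x y

theorem unexhausted_map (e : E ≃ᵢ E) (hD : ∀ x, D' (e x) = D x) :
    unexhausted (e '' S) D' = e '' unexhausted S D := by
  ext x
  obtain ⟨x, rfl⟩ := e.surjective x
  rw [e.injective.mem_set_image]
  simp only [unexhausted, Set.mem_ofPred_eq, e.injective.mem_set_image,
    (stageAfter_map (S := S) e hD _).2]

end Equivariance

section TranslatePair

variable {E : Type*} [NormedAddCommGroup E] [MeasurableSpace E] [BorelSpace E]

/-- The points with stubs left forever, as a function of the point measures of points and marks. -/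
def unexhaustedPoints (q : PointMeasure E × PointMeasure E) : Set E :=
  unexhausted (pointSet (q.1 : Measure E)) (stubCount (q.2 : Measure E))

theorem unexhaustedPoints_translatePair (v : E) (q : PointMeasure E × PointMeasure E) :
    unexhaustedPoints (translatePair v q) = (· + v) '' unexhaustedPoints q := by
  have h := unexhausted_map (S := pointSet (q.1 : Measure E)) (IsometryEquiv.addRight v)
    (stubCount_map_add_right (q.2 : Measure E) v)
  rw [unexhaustedPoints, unexhaustedPoints]
  rw [show pointSet ((translatePair v q).1 : Measure E) = (IsometryEquiv.addRight v) ''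
    pointSet (q.1 : Measure E) from pointSet_map_add_right _ v]
  exact h

theorem limitEdges_translatePair (v : E) (q : PointMeasure E × PointMeasure E) :
    limitEdges (translatePair v q) = (limitEdges q).map fun p => (p.1 + v, p.2 + v) := by
  have hm : Measurable fun p : E × E => (p.1 + v, p.2 + v) :=
    (measurable_fst.add_const v).prodMk (measurable_snd.add_const v)
  have hadj := limitGraph_map_adj (S := pointSet (q.1 : Measure E)) (IsometryEquiv.addRight v)
    (stubCount_map_add_right (q.2 : Measure E) v)
  have hinj : Function.Injective fun p : E × E => (p.1 + v, p.2 + v) := by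
    rintro ⟨a, b⟩ ⟨c, d⟩ h
    simpa using h
  rw [limitEdges, limitEdges, show pointSet ((translatePair v q).1 : Measure E) =
    (IsometryEquiv.addRight v) '' pointSet (q.1 : Measure E) from pointSet_map_add_right _ v]
  ext B hB
  rw [Measure.map_apply hm hB, edgeMeasure_apply _ hB, edgeMeasure_apply _ (hm hB),
    ← hinj.injOn.encard_image (s := {p : E × E | (limitGraph (pointSet (q.1 : Measure E))
      (stubCount (q.2 : Measure E))).Adj p.1 p.2} ∩ _)]
  congr 2
  ext ⟨x, y⟩
  obtain ⟨x, rfl⟩ := (IsometryEquiv.addRight v).surjective x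
  obtain ⟨y, rfl⟩ := (IsometryEquiv.addRight v).surjective y
  constructor
  · rintro ⟨hxy, hxyB⟩
    exact ⟨(x, y), ⟨(hadj x y).1 hxy, hxyB⟩, rfl⟩
  · rintro ⟨⟨a, b⟩, ⟨hab, habB⟩, he⟩
    have he' : (a, b) = (x, y) := hinj he
    rw [Prod.mk.injEq] at he'
    obtain ⟨rfl, rfl⟩ := he'
    exact ⟨(hadj a b).2 hab, habB⟩

variable [SecondCountableTopology E]

/-- In a translation-invariant process of marked points it has probability zero that the set of
points keeping stubs forever is nonempty and finite: such a set would lie with positive probability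
in some ball, hence with the same probability in each of infinitely many disjoint balls. -/
theorem ae_not_nonempty_finite_unexhaustedPoints [NormedSpace ℝ E] [Nontrivial E] {Ω : Type*}
    [MeasurableSpace Ω] {Pr : Measure Ω} [IsProbabilityMeasure Pr]
    {W : Ω → PointMeasure E × PointMeasure E} (hW : Measurable W)
    (hinv : ∀ v, Pr.map (fun ω => translatePair v (W ω)) = Pr.map W) :
    ∀ᵐ ω ∂Pr, ¬ ((unexhaustedPoints (W ω)).Nonempty ∧ (unexhaustedPoints (W ω)).Finite) := by
  have hzero : ∀ R : ℕ, Pr {ω | (unexhaustedPoints (W ω)).Nonempty ∧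
      unexhaustedPoints (W ω) ⊆ Metric.ball 0 R} = 0 := by
    intro R
    by_contra hne
    have hmeas : ∀ v : E, MeasurableSet {q : PointMeasure E × PointMeasure E |
        (unexhaustedPoints q).Nonempty ∧ unexhaustedPoints q ⊆ Metric.ball v R} :=
      fun v => measurableSet_unexhausted_subset Metric.isOpen_ball.measurableSet
    have hshift : ∀ v : E, Pr {ω | (unexhaustedPoints (W ω)).Nonempty ∧
        unexhaustedPoints (W ω) ⊆ Metric.ball v R} = Pr {ω | (unexhaustedPoints (W ω)).Nonempty ∧
          unexhaustedPoints (W ω) ⊆ Metric.ball 0 R} := by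
      intro v
      have h := congrArg (fun ν => ν {q : PointMeasure E × PointMeasure E |
        (unexhaustedPoints q).Nonempty ∧ unexhaustedPoints q ⊆ Metric.ball v R}) (hinv v)
      simp only [Measure.map_apply hW (hmeas v),
        Measure.map_apply ((measurable_translatePair v).fun_comp hW) (hmeas v)] at h
      refine h.symm.trans (congrArg Pr ?_)
      ext ω
      simp only [Set.mem_preimage, Set.mem_ofPred_eq, unexhaustedPoints_translatePair,
        Set.image_nonempty, Set.image_subset_iff]
      refine and_congr_right fun _ => ?_
      have : (· + v) ⁻¹' Metric.ball v R = Metric.ball (0 : E) R := by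
        ext x; simp
      rw [this]
    -- the balls of radius `R` around the multiples of `w` are disjoint
    obtain ⟨w, hw⟩ := exists_norm_eq E (show (0 : ℝ) ≤ 2 * R + 1 by positivity)
    have hfin := Measure.finite_const_le_meas_of_disjoint_iUnion Pr (pos_iff_ne_zero.2 hne)
      (As := fun k : ℕ => W ⁻¹' {q | (unexhaustedPoints q).Nonempty ∧
        unexhaustedPoints q ⊆ Metric.ball ((k : ℝ) • w) R}) (fun k => hW (hmeas _)) ?_
      (measure_ne_top _ _)
    · refine Set.infinite_univ (α := ℕ) (hfin.subset fun k _ => ?_)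
      exact (hshift ((k : ℝ) • w)).ge
    · intro k l hkl
      refine Set.disjoint_left.2 ?_
      rintro ω ⟨⟨x, hx⟩, hk⟩ ⟨-, hl⟩
      have h1 := Metric.mem_ball.1 (hk hx)
      have h2 := Metric.mem_ball.1 (hl hx)
      have h3 := dist_triangle_left ((k : ℝ) • w) ((l : ℝ) • w) x
      have h4 : (1 : ℝ) ≤ |(k : ℝ) - l| := by
        have : (1 : ℤ) ≤ |(k : ℤ) - l| := Int.one_le_abs (sub_ne_zero.2 (by exact_mod_cast hkl))
        exact_mod_cast this
      rw [dist_eq_norm ((k : ℝ) • w), ← sub_smul, norm_smul, hw, Real.norm_eq_abs] at h3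
      have hR : (0 : ℝ) ≤ R := Nat.cast_nonneg R
      nlinarith
  filter_upwards [ae_all_iff.2 fun R => measure_eq_zero_iff_ae_notMem.1 (hzero R)] with ω hω
  rintro ⟨hne, hfin⟩
  obtain ⟨r, hr⟩ := hfin.isBounded.subset_ball (0 : E)
  obtain ⟨R, hR⟩ := exists_nat_ge r
  exact hω R ⟨hne, hr.trans (Metric.ball_subset_ball hR)⟩

end TranslatePair

end MultiMatching

theorem proposition2p2 {d : ℕ} (hd : 1 ≤ d)
    (μ : Measure ℕ) [IsProbabilityMeasure μ] (hμ : μ {0} = 0)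
    {Ω : Type*} [MeasurableSpace Ω] (Pr : Measure Ω) [IsProbabilityMeasure Pr]
    (P ξ : Ω → Measure (EuclideanSpace ℝ (Fin d)))
    (hP : MultiMatching.IsPoissonProcess Pr P)
    (hξ : MultiMatching.IsIIDMarking Pr μ P ξ) :
    (∀ᵐ ω ∂Pr, MultiMatching.ExhaustsStubs
      (MultiMatching.pointSet (P ω)) (MultiMatching.stubCount (ξ ω))) ∧
    -- the limiting graph is a stable multi-matching
    MultiMatching.IsStableMultiMatching Pr P ξ (MultiMatching.limitScheme P ξ) ∧
    -- every stable multi-matching agrees with it almost surely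
    (∀ M : Ω → Measure (EuclideanSpace ℝ (Fin d) × EuclideanSpace ℝ (Fin d)),
      MultiMatching.IsStableMultiMatching Pr P ξ M →
        ∀ᵐ ω ∂Pr, M ω = MultiMatching.limitScheme P ξ ω) ∧
    -- almost surely, it is the only stable graph on the points of P with the given degrees
    (∀ᵐ ω ∂Pr, ∀ G : SimpleGraph (EuclideanSpace ℝ (Fin d)),
      MultiMatching.IsMatchingOn
          (MultiMatching.pointSet (P ω)) (MultiMatching.stubCount (ξ ω)) G →
        MultiMatching.IsStableOn (MultiMatching.pointSet (P ω)) G →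
          G = MultiMatching.limitGraph
            (MultiMatching.pointSet (P ω)) (MultiMatching.stubCount (ξ ω))) := by
  classical
  have : Nonempty (Fin d) := ⟨⟨0, hd⟩⟩
  have hpair := MultiMatching.measurable_pointMeasurePair hP.isPointProcess hξ.isPointProcess
  have hinv := fun v => MultiMatching.IsIIDMarking.map_translatePair_eq hP.isPointProcess hξ v
    ((hP.map_add_right v).map_eq hP)
  have hexh : ∀ᵐ ω ∂Pr, MultiMatching.ExhaustsStubs
      (MultiMatching.pointSet (P ω)) (MultiMatching.stubCount (ξ ω)) := by
    filter_upwards [MultiMatching.ae_not_nonempty_finite_unexhaustedPoints hpair hinv,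
      hP.ae_hasNoTies hd, hP.ae_hasNoDescendingChain hd] with ω hω hties hchain
    rw [MultiMatching.exhaustsStubs_iff, ← Set.not_nonempty_iff_eq_empty]
    exact fun hne => hω ⟨hne, MultiMatching.finite_unexhausted
      (hP.isPointProcess.isPointMeasure ω).finite_pointSet_inter_closedBall hties hchain⟩
  have hunique : ∀ᵐ ω ∂Pr, ∀ G : SimpleGraph (EuclideanSpace ℝ (Fin d)),
      MultiMatching.IsMatchingOn
          (MultiMatching.pointSet (P ω)) (MultiMatching.stubCount (ξ ω)) G →
        MultiMatching.IsStableOn (MultiMatching.pointSet (P ω)) G →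
          G = MultiMatching.limitGraph
            (MultiMatching.pointSet (P ω)) (MultiMatching.stubCount (ξ ω)) := by
    exact hexh.mono fun ω hω G hG hst => hω.eq_limitGraph hG hst
  have hedge : ∀ ω, MultiMatching.edgeGraph (MultiMatching.limitScheme P ξ ω) =
      MultiMatching.limitGraph (MultiMatching.pointSet (P ω)) (MultiMatching.stubCount (ξ ω)) :=
    fun ω => MultiMatching.edgeGraph_edgeMeasure _
  have hscheme := MultiMatching.limitScheme_eq hP.isPointProcess hξ.isPointProcess
  refine ⟨hexh, ⟨⟨⟨hscheme ▸ MultiMatching.measurable_limitEdges.fun_comp hpair, fun ω => ?_⟩,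
    ?_, ?_, ?_, ?_, fun v => ?_⟩, ?_⟩, fun M hM => ?_, hunique⟩
  · exact MultiMatching.isPointMeasure_edgeMeasure
      (fun B hB => (hP.isPointProcess.isPointMeasure ω).finite_pointSet_inter hB)
      fun x y => MultiMatching.limitGraph_adj_mem
  · refine Filter.Eventually.of_forall fun ω x y => ?_
    simp only [MultiMatching.limitScheme, MultiMatching.edgeMeasure_singleton,
      SimpleGraph.adj_comm]
  · refine Filter.Eventually.of_forall fun ω x => ?_
    simp [MultiMatching.limitScheme, MultiMatching.edgeMeasure_singleton]
  · refine Filter.Eventually.of_forall fun ω x y => ?_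
    simp only [MultiMatching.limitScheme, MultiMatching.edgeMeasure_singleton]
    split_ifs <;> simp
  · filter_upwards [hexh] with ω hω
    rw [hedge]
    exact hω.isMatchingOn
  · rw [hscheme]
    simp_rw [← MultiMatching.limitEdges_translatePair]
    exact MultiMatching.map_comp_eq_of_map_eq MultiMatching.measurable_limitEdges
      ((MultiMatching.measurable_translatePair v).fun_comp hpair) hpair (hinv v)
  · filter_upwards [hexh] with ω hω
    rw [hedge]
    exact hω.isStableOn
  · filter_upwards [hunique, hM.symm, hM.no_loops, hM.no_multiple, hM.isMatchingOn, hM.stable]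
      with ω hω hsymm hloop hmult hmatch hstable
    rw [(hM.isPointProcess.isPointMeasure ω).eq_edgeMeasure hsymm hloop hmult,
      hω _ hmatch hstable]
    rfl
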